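/- **Definitions.** A tree is a subset of $\omega^{<\omega}$ closed under initial segments; an isomorphism of trees is a bijection that preserves and reflects extension of sequences. For a tree $T$, $\mathrm{Isom}_T$ is the set of all $e$ such that $\varphi_e$ is the (total) characteristic function of a tree isomorphic to $T$. A set is $\Pi^0_n\wedge\Sigma^0_n$ if it is the intersection of a $\Pi^0_n$ set and a $\Sigma^0_n$ set. For $C,D\subseteq\omega$, $(\Sigma^0_n,\Pi^0_n)\le_1(C,D)$ means that $C\cap D=\emptyset$ and that for every $\Sigma^0_n$ set $A$ there is a one-one computable function $f$ with $f(A)\subseteq C$ and $f(\omega\setminus A)\subseteq D$. **Theorem.** (1) For every $n\ge 2$ there are computable trees $T_{\Sigma_n}$ and $T_{\Pi_n}$ such that $\mathrm{Isom}_{T_{\Pi_n}}$ is $\Pi^0_n$, $\mathrm{Isom}_{T_{\Sigma_n}}$ is $\Pi^0_n\wedge\Sigma^0_n$, and $(\Sigma^0_n,\Pi^0_n)\le_1(\mathrm{Isom}_{T_{\Sigma_n}},\mathrm{Isom}_{T_{\Pi_n}})$. Moreover $\mathrm{Isom}_{T_{\Pi_n}}$ is $\Pi^0_n$-complete (under one-one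 reducibility). (2) There is a uniformly computable list $(T_i)_{i\in\omega}$ of trees, such that whenever $e$ is an index of the characteristic function of a nonempty computable tree $S$, the tree $T_e$ is isomorphic to $S$ by a computable isomorphism, with the following property. For every finite $\alpha$ there is $i_\alpha$ such that, for all computable trees $S$, $S$ and $T_{i_\alpha}$ are isomorphic if and only if they are isomorphic via an isomorphism computable in $\deg(S)\oplus 0^{(\alpha)}$; but for every $\beta<\alpha$ there is $i^*_\beta$ such that $T_{i^*_\beta}$ and $T_{i_\alpha}$ are isomorphic, and not via any isomorphism computable in $0^{(\beta)}$. -/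

import Mathlib

open Nat.Partrec (Code)

namespace TreeIso

/-! ### The arithmetical hierarchy -/

/-- `IsSigma n A`: the set `A` of natural numbers is `Σ⁰ₙ`. It is computable for `n = 0`, and for
`n + 1` it is the projection of a set whose complement is `Σ⁰ₙ`. -/
def IsSigma : ℕ → Set ℕ → Prop
  | 0, A => ComputablePred (fun x => x ∈ A)
  | n + 1, A => ∃ B : Set ℕ, IsSigma n Bᶜ ∧ ∀ x, x ∈ A ↔ ∃ y, Nat.pair x y ∈ B

/-- `A` is `Π⁰ₙ` when its complement is `Σ⁰ₙ`. -/
def IsPi (n : ℕ) (A : Set ℕ) : Prop := IsSigma n Aᶜ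

/-- `A` is the intersection of a `Π⁰ₙ` set and a `Σ⁰ₙ` set. -/
def IsPiAndSigma (n : ℕ) (A : Set ℕ) : Prop :=
  ∃ B C : Set ℕ, IsPi n B ∧ IsSigma n C ∧ A = B ∩ C

/-- `A` is `Π⁰ₙ`-complete with respect to one-one reducibility. -/
def IsPiComplete (n : ℕ) (A : Set ℕ) : Prop :=
  IsPi n A ∧ ∀ B : Set ℕ, IsPi n B → OneOneReducible (fun x => x ∈ B) (fun x => x ∈ A)

/-- `(Σ⁰ₙ, Π⁰ₙ) ≤₁ (C, D)`: the sets `C` and `D` are disjoint, and for every `Σ⁰ₙ` set `A` some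
one-one computable function maps `A` into `C` and the complement of `A` into `D`. -/
def SigmaPiReducible (n : ℕ) (C D : Set ℕ) : Prop :=
  Disjoint C D ∧ ∀ A : Set ℕ, IsSigma n A →
    ∃ f : ℕ → ℕ, Computable f ∧ Function.Injective f ∧
      (∀ x ∈ A, f x ∈ C) ∧ (∀ x ∉ A, f x ∈ D)

/-! ### The Turing jump -/

open Classical in
/-- The characteristic function of a set, as an oracle. -/
noncomputable def chi (A : Set ℕ) : ℕ →. ℕ := fun n => Part.some (if n ∈ A then 1 else 0)

open Classical in
/-- The initial segment of length `s` of the characteristic sequence of `A`. -/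
noncomputable def initSeg (A : Set ℕ) (s : ℕ) : List Bool :=
  (List.range s).map (fun i => decide (i ∈ A))

/-- The `e`-th set computably enumerable in `A`, by the use principle: `x` is in it when the `e`-th
program halts on `x` together with some finite initial segment of `A`. -/
def relCE (A : Set ℕ) (e : ℕ) : Set ℕ :=
  {x | ∃ s, ((Denumerable.ofNat Code e).eval
    (Nat.pair x (Encodable.encode (initSeg A s)))).Dom}

/-- The Turing jump of `A`. -/
def jump (A : Set ℕ) : Set ℕ := {e | e ∈ relCE A e}

/-- The `n`-th jump `0⁽ⁿ⁾` of the empty set. -/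
def zeroJump (n : ℕ) : Set ℕ := jump^[n] ∅

/-! ### Trees -/

/-- A tree is a set of finite sequences of natural numbers closed under initial segments. -/
def IsTree (S : Set (List ℕ)) : Prop := ∀ σ τ : List ℕ, σ <+: τ → τ ∈ S → σ ∈ S

/-- A computable tree. -/
def IsComputableTree (S : Set (List ℕ)) : Prop :=
  IsTree S ∧ ComputablePred (fun σ => σ ∈ S)

/-- An isomorphism of trees: a bijection of the nodes that preserves and reflects extension. -/
abbrev Iso (S T : Set (List ℕ)) : Type :=
  (fun σ τ : S => σ.1 <+: τ.1) ≃r (fun σ τ : T => σ.1 <+: τ.1)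

/-- The isomorphism `Λ` is computable with the oracles in `O`. -/
def Iso.IsComputableIn {S T : Set (List ℕ)} (O : Set (ℕ →. ℕ)) (Λ : Iso S T) : Prop :=
  ∃ g : List ℕ → List ℕ, ComputableIn O g ∧ ∀ σ : S, g σ.1 = (Λ σ).1

/-- The set of codes of the nodes of `S`. -/
def codes (S : Set (List ℕ)) : Set ℕ := {n | ∃ σ ∈ S, Encodable.encode σ = n}

open Classical in
/-- `e` is an index of the total computable characteristic function of `S`. -/
def IsIndex (e : ℕ) (S : Set (List ℕ)) : Prop :=
  ∀ σ : List ℕ, (Denumerable.ofNat Code e).eval (Encodable.encode σ) =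
    Part.some (if σ ∈ S then 1 else 0)

/-- The isomorphism index set of `T`: all indices of computable trees isomorphic to `T`. -/
def Isom (T : Set (List ℕ)) : Set ℕ :=
  {e | ∃ S : Set (List ℕ), IsTree S ∧ IsIndex e S ∧ Nonempty (Iso S T)}

/-- A computable listing of computable trees in which, up to computable isomorphism, every nonempty
computable tree appears, at the position given by any index of it. -/
structure IsTreeListing (T : ℕ → Set (List ℕ)) : Prop where
  isTree : ∀ i, IsTree (T i)
  computable : ComputablePred (fun p : ℕ × List ℕ => p.2 ∈ T p.1)
  complete : ∀ (e : ℕ) (S : Set (List ℕ)), IsTree S → S.Nonempty → IsIndex e S →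
    ∃ Λ : Iso S (T e), Λ.IsComputableIn ∅

end TreeIso

/-!
The trees are classified by `Kind`. Up to isomorphism there is one tree of height at most `n` of
kind `0`, the tree `std n 0`, and one of kind `1`, the tree `std n 1`. At level `0` these are a
single node and the empty tree. At level `n + 1` the tree `std n 1` lies above infinitely many
children of the root (which for `n = 0` means nothing, as it is empty), and `std n 0` lies above
no child in the case of `std (n + 1) 0`, above exactly one child in the case of `std (n + 1) 1`.
These are the trees for `Π⁰ₙ` and `Σ⁰ₙ`.

*Complexity of the index sets.* That a tree is of kind `0` at level `n + 1` says that the part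
above each child is of kind `1` at level `n`; kind `1` says that there is exactly one exception,
of kind `0`. By induction kind `0` is a `Π⁰ₙ` condition and kind `1` the conjunction of a `Π⁰ₙ`
and a `Σ⁰ₙ` condition (`kind_complexity`). Kinds are invariant under isomorphism (`Kind.of_iso`)
and determine a tree of bounded height up to isomorphism (`exists_canonical_iso`). An index `e` is
replaced by the `e`-th tree of a uniformly computable listing, so that partial functions play no
role beyond a `Π⁰₂` condition (`mem_isom_std_iff`).

*Completeness.* Every `Σ⁰ₙ₊₁` predicate is `∃ y, q (a, y)` with `q` a `Π⁰ₙ` predicate and at most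
one witness (`SigmaPred.exists_unique_witness`). Putting above the child `y` of the root a tree
that codes the failure of `q (a, y)` yields, by recursion, computable trees of kind `1` where the
predicate holds and of kind `0` where it fails (`exists_truncTree_kind`).

*Complexity of isomorphisms.* For the second part the tree is `std (α + 1) ⊤`, with infinitely
many copies of both `std α 0` and `std α 1` above the children of the root. Matching the children
of each kind in increasing order gives an isomorphism from any computable copy, and its graph is
`Σ⁰_{α+1}` since the kinds of the nodes are `Δ⁰_{α+1}`. A total function with such a graph is
computable in the `α`-th jump (`computableIn_of_sigmaPred_graph`), and conversely functions
computable in the `β`-th jump have `Σ⁰_{β+1}` graphs (`sigmaPred_graph_of_recursiveIn`). So an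
isomorphism computable in the `β`-th jump, `β < α`, from a copy whose children code a `Σ⁰_α`
predicate would make that predicate `Δ⁰_{β+1}`, against the hierarchy theorem
(`exists_sigma_not_pi`).
-/

namespace TreeIso

/-! ### Closure properties of computable predicates -/

section Computable

variable {α β : Type} [Primcodable α] [Primcodable β]

theorem _root_.ComputablePred.comp {p : β → Prop} (hp : ComputablePred p) {f : α → β}
    (hf : Computable f) : ComputablePred fun a => p (f a) := by
  obtain ⟨f', hf', rfl⟩ := ComputablePred.computable_iff.1 hp
  exact ComputablePred.computable_iff.2 ⟨_, hf'.comp hf, rfl⟩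

theorem _root_.ComputablePred.and {p q : α → Prop} (hp : ComputablePred p) (hq : ComputablePred q) :
    ComputablePred fun a => p a ∧ q a := by
  obtain ⟨f, hf, rfl⟩ := ComputablePred.computable_iff.1 hp
  obtain ⟨g, hg, rfl⟩ := ComputablePred.computable_iff.1 hq
  refine ComputablePred.computable_iff.2 ⟨fun a => f a && g a,
    Primrec.and.to_comp.comp hf hg, ?_⟩
  funext a; simp

theorem _root_.ComputablePred.or {p q : α → Prop} (hp : ComputablePred p) (hq : ComputablePred q) :
    ComputablePred fun a => p a ∨ q a :=
  ((hp.not |> ComputablePred.and <| hq.not).not).of_eq fun a => by tauto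

theorem _root_.ComputablePred.forall_lt {p : α × ℕ → Prop} (hp : ComputablePred p) :
    ComputablePred fun z : α × ℕ => ∀ i < z.2, p (z.1, i) := by
  obtain ⟨f, hf, rfl⟩ := ComputablePred.computable_iff.1 hp
  refine ComputablePred.computable_iff.2
    ⟨fun z => Nat.rec true (fun i b => b && f (z.1, i)) z.2, ?_, ?_⟩
  · refine Computable.nat_rec (f := fun z : α × ℕ => z.2) (g := fun _ => true)
      (h := fun z w => w.2 && f (z.1, w.1)) Computable.snd (Computable.const true) ?_
    exact Primrec.and.to_comp.comp (Computable.snd.comp Computable.snd)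
      (hf.comp ((Computable.fst.comp Computable.fst).pair (Computable.fst.comp Computable.snd)))
  · funext ⟨a, k⟩
    induction k with
    | zero => simp
    | succ k ih =>
      simp only [eq_iff_iff] at ih
      simp only [Nat.lt_succ_iff_lt_or_eq, Bool.and_eq_true, eq_iff_iff, ← ih]
      constructor
      · exact fun h => ⟨fun i hi => h i (.inl hi), h k (.inr rfl)⟩
      · rintro ⟨h, h'⟩ i (hi | rfl)
        exacts [h i hi, h']

end Computable

/-! ### The arithmetical hierarchy for predicates on coded types -/

/-- `Σ⁰ₙ` predicates on an arbitrary coded type; on `ℕ` this is `IsSigma`. Working with predicates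
keeps pairing functions out of the closure properties. -/
def SigmaPred : ℕ → ∀ {α : Type} [Primcodable α], (α → Prop) → Prop
  | 0, _, _, p => ComputablePred p
  | n + 1, α, _, p => ∃ q : α × ℕ → Prop, SigmaPred n (fun z => ¬ q z) ∧ ∀ a, p a ↔ ∃ y, q (a, y)

/-- `Π⁰ₙ` predicates on a coded type. -/
def PiPred (n : ℕ) {α : Type} [Primcodable α] (p : α → Prop) : Prop :=
  SigmaPred n fun a => ¬ p a

/-- `Δ⁰ₙ` predicates on a coded type. -/
def DeltaPred (n : ℕ) {α : Type} [Primcodable α] (p : α → Prop) : Prop :=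
  SigmaPred n p ∧ PiPred n p

section Hierarchy

variable {α β : Type} [Primcodable α] [Primcodable β] {n : ℕ} {p q : α → Prop}

theorem SigmaPred.of_iff (hp : SigmaPred n p) (h : ∀ a, p a ↔ q a) : SigmaPred n q :=
  (funext fun a => propext (h a) : p = q) ▸ hp

theorem PiPred.of_iff (hp : PiPred n p) (h : ∀ a, p a ↔ q a) : PiPred n q :=
  (funext fun a => propext (h a) : p = q) ▸ hp

theorem DeltaPred.of_iff (hp : DeltaPred n p) (h : ∀ a, p a ↔ q a) : DeltaPred n q :=
  (funext fun a => propext (h a) : p = q) ▸ hp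

theorem PiPred.not (hp : PiPred n p) : SigmaPred n fun a => ¬ p a := hp

theorem SigmaPred.not (hp : SigmaPred n p) : PiPred n fun a => ¬ p a :=
  SigmaPred.of_iff hp fun a => by simp

theorem DeltaPred.not (hp : DeltaPred n p) : DeltaPred n fun a => ¬ p a :=
  ⟨hp.2.not, hp.1.not⟩

theorem SigmaPred.comp {n : ℕ} {α β : Type} [Primcodable α] [Primcodable β] {p : α → Prop}
    (hp : SigmaPred n p) {f : β → α} (hf : Computable f) : SigmaPred n fun b => p (f b) := by
  induction n generalizing α β with
  | zero => exact ComputablePred.comp (p := p) hp hf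
  | succ n ih =>
    obtain ⟨q, hq, h⟩ := hp
    exact ⟨fun z => q (f z.1, z.2),
      ih hq ((hf.comp Computable.fst).pair Computable.snd), fun b => h (f b)⟩

theorem PiPred.comp (hp : PiPred n p) {f : β → α} (hf : Computable f) :
    PiPred n fun b => p (f b) :=
  SigmaPred.comp (p := fun a => ¬ p a) hp hf

theorem DeltaPred.comp (hp : DeltaPred n p) {f : β → α} (hf : Computable f) :
    DeltaPred n fun b => p (f b) :=
  ⟨hp.1.comp hf, hp.2.comp hf⟩

theorem PiPred.sigma_succ (hp : PiPred n p) : SigmaPred (n + 1) p :=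
  ⟨fun z => p z.1, PiPred.comp hp Computable.fst, fun a => by simp⟩

theorem SigmaPred.pi_succ (hp : SigmaPred n p) : PiPred (n + 1) p :=
  PiPred.sigma_succ (p := fun a => ¬ p a) hp.not

theorem SigmaPred.succ {n : ℕ} {α : Type} [Primcodable α] {p : α → Prop} (hp : SigmaPred n p) :
    SigmaPred (n + 1) p := by
  induction n generalizing α with
  | zero => exact PiPred.sigma_succ (ComputablePred.not hp)
  | succ n ih =>
    obtain ⟨q, hq, h⟩ := hp
    exact ⟨q, ih hq, h⟩

theorem PiPred.succ (hp : PiPred n p) : PiPred (n + 1) p := SigmaPred.succ hp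

theorem SigmaPred.delta_succ (hp : SigmaPred n p) : DeltaPred (n + 1) p := ⟨hp.succ, hp.pi_succ⟩

theorem PiPred.delta_succ (hp : PiPred n p) : DeltaPred (n + 1) p := ⟨hp.sigma_succ, hp.succ⟩

theorem SigmaPred.mono (hp : SigmaPred n p) {m : ℕ} (h : n ≤ m) : SigmaPred m p := by
  induction h with
  | refl => exact hp
  | step _ ih => exact ih.succ

theorem PiPred.mono (hp : PiPred n p) {m : ℕ} (h : n ≤ m) : PiPred m p := SigmaPred.mono hp h

theorem DeltaPred.mono (hp : DeltaPred n p) {m : ℕ} (h : n ≤ m) : DeltaPred m p :=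
  ⟨hp.1.mono h, hp.2.mono h⟩

theorem delta_of_computable (hp : ComputablePred p) (n : ℕ) : DeltaPred n p :=
  DeltaPred.mono (n := 0) ⟨hp, ComputablePred.not hp⟩ n.zero_le

theorem SigmaPred.and_or {n : ℕ} {α : Type} [Primcodable α] {p q : α → Prop} (hp : SigmaPred n p)
    (hq : SigmaPred n q) :
    SigmaPred n (fun a => p a ∧ q a) ∧ SigmaPred n (fun a => p a ∨ q a) := by
  induction n generalizing α with
  | zero => exact ⟨ComputablePred.and hp hq, ComputablePred.or hp hq⟩
  | succ n ih =>
    obtain ⟨p', hp', h⟩ := hp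
    obtain ⟨q', hq', h'⟩ := hq
    refine ⟨⟨fun z => p' (z.1, z.2.unpair.1) ∧ q' (z.1, z.2.unpair.2), ?_, fun a => ?_⟩,
      ⟨fun z => p' z ∨ q' z, ?_, fun a => ?_⟩⟩
    · have h₁ : Computable fun z : α × ℕ => (z.1, z.2.unpair.1) :=
        Computable.fst.pair (Computable.fst.comp (Computable.unpair.comp Computable.snd))
      have h₂ : Computable fun z : α × ℕ => (z.1, z.2.unpair.2) :=
        Computable.fst.pair (Computable.snd.comp (Computable.unpair.comp Computable.snd))
      exact (ih (SigmaPred.comp hp' h₁) (SigmaPred.comp hq' h₂)).2.of_iff fun z => by tauto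
    · simp only [h, h']
      constructor
      · rintro ⟨⟨y, hy⟩, y', hy'⟩
        exact ⟨Nat.pair y y', by simpa using ⟨hy, hy'⟩⟩
      · rintro ⟨y, hy, hy'⟩
        exact ⟨⟨_, hy⟩, _, hy'⟩
    · exact (ih hp' hq').1.of_iff fun z => by tauto
    · simp only [h, h', exists_or]

theorem SigmaPred.and (hp : SigmaPred n p) (hq : SigmaPred n q) :
    SigmaPred n fun a => p a ∧ q a := (hp.and_or hq).1

theorem SigmaPred.or (hp : SigmaPred n p) (hq : SigmaPred n q) :
    SigmaPred n fun a => p a ∨ q a := (hp.and_or hq).2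

theorem PiPred.and (hp : PiPred n p) (hq : PiPred n q) : PiPred n fun a => p a ∧ q a :=
  (SigmaPred.or hp hq).of_iff fun a => by tauto

theorem PiPred.or (hp : PiPred n p) (hq : PiPred n q) : PiPred n fun a => p a ∨ q a :=
  (SigmaPred.and hp hq).of_iff fun a => by tauto

theorem DeltaPred.and (hp : DeltaPred n p) (hq : DeltaPred n q) :
    DeltaPred n fun a => p a ∧ q a := ⟨hp.1.and hq.1, hp.2.and hq.2⟩

theorem DeltaPred.or (hp : DeltaPred n p) (hq : DeltaPred n q) :
    DeltaPred n fun a => p a ∨ q a := ⟨hp.1.or hq.1, hp.2.or hq.2⟩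

theorem DeltaPred.iff (hp : DeltaPred n p) (hq : DeltaPred n q) :
    DeltaPred n fun a => (p a ↔ q a) :=
  ((hp.and hq).or (hp.not.and hq.not)).of_iff fun a => by tauto

theorem PiPred.imp (hp : SigmaPred n p) (hq : PiPred n q) : PiPred n fun a => p a → q a :=
  (hp.not.or hq).of_iff fun a => by tauto

theorem SigmaPred.ex [Inhabited β] {p : α × β → Prop} (hp : SigmaPred (n + 1) p) :
    SigmaPred (n + 1) fun a => ∃ b, p (a, b) := by
  obtain ⟨q, hq, h⟩ := hp
  let d : ℕ → β × ℕ := fun k => (Encodable.decode k).getD default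
  have hd : Computable d := Computable.option_getD Computable.decode (Computable.const _)
  refine ⟨fun z => q ((z.1, (d z.2).1), (d z.2).2), ?_, fun a => ?_⟩
  · have hd' : Computable fun z : α × ℕ => d z.2 := hd.comp Computable.snd
    exact SigmaPred.comp hq
      ((Computable.fst.pair (Computable.fst.comp hd')).pair (Computable.snd.comp hd'))
  · constructor
    · rintro ⟨b, hb⟩
      obtain ⟨y, hy⟩ := (h _).1 hb
      exact ⟨Encodable.encode (b, y), by simpa [d, Encodable.encodek] using hy⟩
    · rintro ⟨y, hy⟩
      exact ⟨_, (h _).2 ⟨_, hy⟩⟩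

theorem PiPred.all [Inhabited β] {p : α × β → Prop} (hp : PiPred (n + 1) p) :
    PiPred (n + 1) fun a => ∀ b, p (a, b) :=
  (SigmaPred.ex (p := fun z => ¬ p z) hp).of_iff fun a => by simp

theorem computablePred_snd_lt : ComputablePred fun z : (α × ℕ) × ℕ => z.2 < z.1.2 :=
  (Primrec.nat_lt.comp Primrec.snd (Primrec.snd.comp Primrec.fst)).computablePred

/-- Bounded universal quantification: the witnesses for all `i < k` are collected in a list. -/
theorem SigmaPred.forall_lt {p : α × ℕ → Prop} (hp : SigmaPred n p) :
    SigmaPred n fun z : α × ℕ => ∀ i < z.2, p (z.1, i) := by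
  cases n with
  | zero => exact ComputablePred.forall_lt hp
  | succ n =>
    obtain ⟨q, hq, h⟩ := hp
    have hf : Computable fun u : (α × ℕ × List ℕ) × ℕ => ((u.1.1, u.2), u.1.2.2.getD u.2 0) :=
      ((Computable.fst.comp Computable.fst).pair Computable.snd).pair
        ((Primrec.list_getD 0).to_comp.comp
          (Computable.snd.comp (Computable.snd.comp Computable.fst)) Computable.snd)
    have hlt : ComputablePred fun u : (α × ℕ × List ℕ) × ℕ => u.2 < u.1.2.1 :=
      (Primrec.nat_lt.comp Primrec.snd
        (Primrec.fst.comp (Primrec.snd.comp Primrec.fst))).computablePred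
    have key : PiPred n fun u : α × ℕ × List ℕ =>
        ∀ i < u.2.1, q ((u.1, i), u.2.2.getD i 0) := by
      cases n with
      | zero =>
        have hq' : ComputablePred q := (ComputablePred.not hq).of_eq fun z => by simp
        have h₁ : ComputablePred fun u : (α × ℕ × List ℕ) × ℕ =>
            q ((u.1.1, u.2), u.1.2.2.getD u.2 0) := ComputablePred.comp hq' hf
        exact ComputablePred.not (ComputablePred.comp (ComputablePred.forall_lt h₁)
          (f := fun u : α × ℕ × List ℕ => (u, u.2.1))
          (Computable.id.pair (Computable.fst.comp Computable.snd)))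
      | succ n =>
        refine PiPred.of_iff (PiPred.all (β := ℕ) (p := fun u : (α × ℕ × List ℕ) × ℕ =>
          u.2 < u.1.2.1 → q ((u.1.1, u.2), u.1.2.2.getD u.2 0))
          (PiPred.imp (delta_of_computable hlt _).1 (PiPred.comp hq hf))) fun u => Iff.rfl
    have hc : Computable fun u : (α × ℕ) × List ℕ => (u.1.1, u.1.2, u.2) :=
      (Computable.fst.comp Computable.fst).pair
        ((Computable.snd.comp Computable.fst).pair Computable.snd)
    refine ((key.sigma_succ.comp hc).ex).of_iff fun z => ?_
    constructor
    · rintro ⟨w, hw⟩ i hi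
      exact (h _).2 ⟨_, hw i hi⟩
    · intro hz
      choose! w hw using fun i hi => (h _).1 (hz i hi)
      refine ⟨(List.range z.2).map w, fun i hi => ?_⟩
      have hi' : i < z.2 := hi
      simpa [List.getD, hi'] using hw i hi'

theorem PiPred.forall_lt {p : α × ℕ → Prop} (hp : PiPred n p) :
    PiPred n fun z : α × ℕ => ∀ i < z.2, p (z.1, i) := by
  cases n with
  | zero => exact ComputablePred.not (ComputablePred.forall_lt
      ((ComputablePred.not hp).of_eq fun z => by simp))
  | succ n =>
    have hc : Computable fun u : (α × ℕ) × ℕ => (u.1.1, u.2) :=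
      (Computable.fst.comp Computable.fst).pair Computable.snd
    exact (PiPred.all (PiPred.imp (delta_of_computable computablePred_snd_lt _).1
      (hp.comp hc))).of_iff fun z => Iff.rfl

theorem DeltaPred.forall_lt {p : α × ℕ → Prop} (hp : DeltaPred n p) :
    DeltaPred n fun z : α × ℕ => ∀ i < z.2, p (z.1, i) := ⟨hp.1.forall_lt, hp.2.forall_lt⟩

theorem isSigma_iff {n : ℕ} {A : Set ℕ} : IsSigma n A ↔ SigmaPred n fun x => x ∈ A := by
  induction n generalizing A with
  | zero => exact Iff.rfl
  | succ n ih =>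
    constructor
    · rintro ⟨B, hB, h⟩
      exact ⟨fun z => Nat.pair z.1 z.2 ∈ B,
        SigmaPred.comp (ih.1 hB) (f := fun z : ℕ × ℕ => Nat.pair z.1 z.2)
          (Primrec₂.natPair.to_comp.comp Computable.fst Computable.snd), h⟩
    · rintro ⟨q, hq, h⟩
      refine ⟨{k | q k.unpair}, ih.2 (SigmaPred.comp hq Computable.unpair), fun x => ?_⟩
      simpa using h x

theorem isPi_iff {A : Set ℕ} : IsPi n A ↔ PiPred n fun x => x ∈ A := isSigma_iff

/-- The graph of a sequence defined by a `Σ⁰ₙ₊₁` step relation is `Σ⁰ₙ₊₁`. -/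
theorem SigmaPred.iterate {P : α × ℕ → Prop} {R : α × ℕ × ℕ × ℕ → Prop}
    (hP : SigmaPred (n + 1) P) (hR : SigmaPred (n + 1) R) :
    SigmaPred (n + 1) fun z : α × ℕ × ℕ => ∃ w : List ℕ, P (z.1, w.getD 0 0) ∧
      (∀ i < z.2.1, R (z.1, i, w.getD i 0, w.getD (i + 1) 0)) ∧ w.getD z.2.1 0 = z.2.2 := by
  have w0 : Computable₂ fun (l : List ℕ) i => l.getD i 0 := (Primrec.list_getD 0).to_comp
  let τ := (α × ℕ × ℕ) × List ℕ
  have c1 : Computable fun u : τ => u.1.1 := Computable.fst.comp Computable.fst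
  have c2 : Computable fun u : τ => u.1.2.1 :=
    Computable.fst.comp (Computable.snd.comp Computable.fst)
  have c3 : Computable fun u : τ => u.1.2.2 :=
    Computable.snd.comp (Computable.snd.comp Computable.fst)
  have h1 : SigmaPred (n + 1) fun u : τ => P (u.1.1, u.2.getD 0 0) :=
    hP.comp (c1.pair (w0.comp Computable.snd (Computable.const 0)))
  have h2 : SigmaPred (n + 1) fun u : τ × ℕ =>
      R (u.1.1.1, u.2, u.1.2.getD u.2 0, u.1.2.getD (u.2 + 1) 0) := by
    have c4 : Computable fun u : τ × ℕ => u.1.2 := Computable.snd.comp Computable.fst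
    exact hR.comp ((c1.comp Computable.fst).pair (Computable.snd.pair
      ((w0.comp c4 Computable.snd).pair (w0.comp c4 (Computable.succ.comp Computable.snd)))))
  have h3 : ComputablePred fun u : τ => u.2.getD u.1.2.1 0 = u.1.2.2 := by
    have := (Primrec.eq (α := ℕ)).computablePred
    exact ComputablePred.comp this (f := fun u : τ => (u.2.getD u.1.2.1 0, u.1.2.2))
      ((w0.comp Computable.snd c2).pair c3)
  exact (h1.and ((h2.forall_lt.comp (f := fun u : τ => (u, u.1.2.1))
    (Computable.id.pair c2)).and (delta_of_computable h3 _).1)).ex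

end Hierarchy

/-! ### The hierarchy theorem -/

theorem _root_.Computable.computablePred_eq {α β : Type} [Primcodable α] [Primcodable β]
    {f g : α → β} (hf : Computable f) (hg : Computable g) : ComputablePred fun a => f a = g a :=
  ComputablePred.comp (p := fun z : β × β => z.1 = z.2) (Primrec.eq (α := β)).computablePred
    (hf.pair hg)

theorem computablePred_evaln_isSome {α : Type} [Primcodable α] {c : α → Code} {x : α → ℕ}
    (hc : Computable c) (hx : Computable x) :
    ComputablePred fun z : α × ℕ => (Code.evaln z.2 (c z.1) (x z.1)).isSome :=
  ComputablePred.computable_iff.2 ⟨_, Primrec.option_isSome.to_comp.comp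
    (Code.primrec_evaln.to_comp.comp ((Computable.snd.pair (hc.comp Computable.fst)).pair
      (hx.comp Computable.fst))), rfl⟩

theorem eval_dom_iff {c : Code} {x : ℕ} : (c.eval x).Dom ↔ ∃ s, (Code.evaln s c x).isSome := by
  simp only [Part.dom_iff_mem, Option.isSome_iff_exists, Code.evaln_complete]
  exact exists_comm

theorem sigmaPred_one_eval_dom {α : Type} [Primcodable α] {c : α → Code} {x : α → ℕ}
    (hc : Computable c) (hx : Computable x) : SigmaPred 1 fun a => ((c a).eval (x a)).Dom :=
  ⟨_, ComputablePred.not (computablePred_evaln_isSome hc hx), fun _ => eval_dom_iff⟩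

theorem exists_code_dom_iff {p : ℕ → Prop} (hp : SigmaPred 1 p) :
    ∃ c : Code, ∀ x, p x ↔ (c.eval x).Dom := by
  obtain ⟨q, hq, h⟩ := hp
  have hq' : ComputablePred q := (ComputablePred.not hq).of_eq fun z => by simp
  obtain ⟨f, hf, rfl⟩ := ComputablePred.computable_iff.1 hq'
  have : Partrec fun x : ℕ => Nat.rfind fun y => Part.some (f (x, y)) :=
    Partrec.rfind hf.partrec
  obtain ⟨c, hc⟩ := Code.exists_code.1 (Partrec.nat_iff.1 this)
  refine ⟨c, fun x => ?_⟩
  rw [hc, h]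
  refine Iff.trans ?_ (Nat.rfind_dom (p := fun y => Part.some (f (x, y)))).symm
  simp

/-- There is a universal `Σ⁰ₙ₊₁` relation. -/
theorem exists_universal (n : ℕ) : ∃ U : ℕ × ℕ → Prop, SigmaPred (n + 1) U ∧
    ∀ p : ℕ → Prop, SigmaPred (n + 1) p → ∃ e, ∀ x, p x ↔ U (e, x) := by
  induction n with
  | zero =>
    refine ⟨fun z => ((Denumerable.ofNat Code z.1).eval z.2).Dom,
      sigmaPred_one_eval_dom ((Computable.ofNat Code).comp Computable.fst) Computable.snd,
      fun p hp => ?_⟩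
    obtain ⟨c, hc⟩ := exists_code_dom_iff hp
    exact ⟨Encodable.encode c, fun x => by simp [hc]⟩
  | succ n ih =>
    obtain ⟨U, hU, hu⟩ := ih
    refine ⟨fun z => ∃ y, ¬ U (z.1, Nat.pair z.2 y), ⟨fun u => ¬ U (u.1.1, Nat.pair u.1.2 u.2), ?_,
      fun _ => Iff.rfl⟩, ?_⟩
    · have hc : Computable fun u : (ℕ × ℕ) × ℕ => (u.1.1, Nat.pair u.1.2 u.2) :=
        (Computable.fst.comp Computable.fst).pair (Primrec₂.natPair.to_comp.comp
          (Computable.snd.comp Computable.fst) Computable.snd)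
      exact (hU.comp hc).of_iff fun u => by simp
    · rintro p ⟨q, hq, h⟩
      obtain ⟨e, he⟩ := hu (fun k => ¬ q k.unpair) (hq.comp Computable.unpair)
      refine ⟨e, fun x => ?_⟩
      rw [h]
      refine exists_congr fun y => ?_
      have := he (Nat.pair x y)
      rw [Nat.unpair_pair] at this
      tauto

theorem exists_sigma_not_pi (n : ℕ) :
    ∃ p : ℕ → Prop, SigmaPred (n + 1) p ∧ ¬ PiPred (n + 1) p := by
  obtain ⟨U, hU, hu⟩ := exists_universal n
  refine ⟨fun x => U (x, x), hU.comp (Computable.id.pair Computable.id), fun h => ?_⟩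
  obtain ⟨e, he⟩ := hu _ h
  have := he e
  tauto

/-! ### Unique witnesses -/

/-- A `Σ⁰ₙ₊₁` predicate has a definition in which the outermost existential quantifier has at most
one witness. For `n = 0` one takes the least witness. In general the witness is the least `y`
together with the list of the unique witnesses to the failure of every smaller number. -/
theorem SigmaPred.exists_unique_witness {n : ℕ} {α : Type} [Primcodable α] {p : α → Prop}
    (hp : SigmaPred (n + 1) p) : ∃ q : α × ℕ → Prop, SigmaPred n (fun z => ¬ q z) ∧
      (∀ a, p a ↔ ∃ y, q (a, y)) ∧ ∀ a y y', q (a, y) → q (a, y') → y = y' := by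
  induction n generalizing α with
  | zero =>
    obtain ⟨q, hq, h⟩ := hp
    refine ⟨fun z => q z ∧ ∀ i < z.2, ¬ q (z.1, i), ?_, fun a => ?_, ?_⟩
    · have h₁ := ComputablePred.forall_lt (p := fun z => ¬ q z) hq
      have h₂ : ComputablePred q := (ComputablePred.not hq).of_eq fun z => by simp
      exact ComputablePred.not (ComputablePred.and h₂ h₁)
    · rw [h]
      constructor
      · rintro hy
        classical
        exact ⟨Nat.find hy, Nat.find_spec hy, fun i hi => Nat.find_min hy hi⟩
      · rintro ⟨y, hy, -⟩
        exact ⟨y, hy⟩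
    · rintro a y y' ⟨h₁, h₂⟩ ⟨h₁', h₂'⟩
      exact le_antisymm (not_lt.1 fun hl => h₂ _ hl h₁') (not_lt.1 fun hl => h₂' _ hl h₁)
  | succ n ih =>
    obtain ⟨q, hq, h⟩ := hp
    obtain ⟨r, hr, hqr, hru⟩ := ih hq
    let D : ℕ → ℕ × List ℕ := Denumerable.ofNat (ℕ × List ℕ)
    have hD : Computable D :=
      (Computable.option_getD Computable.decode (Computable.const default)).of_eq fun k => by
        simp [D, Denumerable.decode_eq_ofNat]
    let q' : α × ℕ × List ℕ → Prop := fun u =>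
      (q (u.1, u.2.1) ∧ u.2.2.length = u.2.1) ∧ ∀ i, i < u.2.1 → r ((u.1, i), u.2.2.getD i 0)
    have hq' : PiPred (n + 1) q' := by
      have f1 : Computable fun u : α × ℕ × List ℕ => u.2.1 :=
        Computable.fst.comp Computable.snd
      have f2 : Computable fun u : α × ℕ × List ℕ => u.2.2 :=
        Computable.snd.comp Computable.snd
      refine PiPred.and (PiPred.and (PiPred.comp hq (Computable.fst.pair f1))
        (delta_of_computable (Computable.computablePred_eq
          (Computable.list_length.comp f2) f1) _).2) ?_
      refine PiPred.all (p := fun v : (α × ℕ × List ℕ) × ℕ =>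
        v.2 < v.1.2.1 → r ((v.1.1, v.2), v.1.2.2.getD v.2 0)) (PiPred.imp
          (delta_of_computable ?_ _).1 (PiPred.succ (PiPred.comp hr ?_)))
      · exact (Primrec.nat_lt.comp Primrec.snd
          (Primrec.fst.comp (Primrec.snd.comp Primrec.fst))).computablePred
      · exact ((Computable.fst.comp Computable.fst).pair Computable.snd).pair
          ((Primrec.list_getD 0).to_comp.comp (f2.comp Computable.fst) Computable.snd)
    refine ⟨fun z => q' (z.1, D z.2),
      PiPred.comp hq' (Computable.fst.pair (hD.comp Computable.snd)), fun a => ?_, ?_⟩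
    · rw [h]
      constructor
      · intro hy
        classical
        have hw : ∀ i < Nat.find hy, ∃ w, r ((a, i), w) := fun i hi =>
          (hqr _).1 (Nat.find_min hy hi)
        choose! w hw using hw
        refine ⟨Encodable.encode (Nat.find hy, (List.range (Nat.find hy)).map w), ?_⟩
        simp only [D, Denumerable.ofNat_encode, q']
        refine ⟨⟨Nat.find_spec hy, by simp⟩, fun i hi => ?_⟩
        rw [List.getD_eq_getElem _ _ (by simpa using hi)]
        simpa using hw i hi
      · rintro ⟨k, ⟨hk, -⟩, -⟩
        exact ⟨_, hk⟩
    · rintro a k k' ⟨⟨h₁, h₂⟩, h₃⟩ ⟨⟨h₁', h₂'⟩, h₃'⟩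
      dsimp only at h₁ h₂ h₃ h₁' h₂' h₃'
      have hy : (D k).1 = (D k').1 := le_antisymm
        (not_lt.1 fun hl => (hqr _).2 ⟨_, h₃ _ hl⟩ h₁')
        (not_lt.1 fun hl => (hqr _).2 ⟨_, h₃' _ hl⟩ h₁)
      have hw : (D k).2 = (D k').2 := by
        refine List.ext_getElem (by omega) fun i hi hi' => ?_
        have e := hru _ _ _ (h₃ i (by omega)) (h₃' i (by omega))
        rwa [List.getD_eq_getElem _ _ hi, List.getD_eq_getElem _ _ hi'] at e
      have hDD : D k = D k' := Prod.ext hy hw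
      simpa [D] using congrArg Encodable.encode hDD

/-! ### The iterated jump and the hierarchy -/

theorem eq_initSeg_iff {A : Set ℕ} {z : List Bool} :
    z = initSeg A z.length ↔ ∀ i < z.length, (z.getD i false = true ↔ i ∈ A) := by
  constructor
  · intro h i hi
    rw [List.getD_eq_getElem _ _ hi]
    have : z[i] = (initSeg A z.length)[i]'(by simpa [initSeg] using hi) := by
      congr 1
    rw [this]
    simp [initSeg]
  · intro h
    refine List.ext_getElem (by simp [initSeg]) fun i hi hi' => ?_
    have := h i hi
    rw [List.getD_eq_getElem _ _ hi] at this
    rw [Bool.eq_iff_iff, this]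
    simp [initSeg]

theorem deltaPred_eq_initSeg {n : ℕ} {A : Set ℕ} (hA : DeltaPred n fun x => x ∈ A) :
    DeltaPred n fun z : List Bool => z = initSeg A z.length := by
  have h₁ : ComputablePred fun u : List Bool × ℕ => u.1.getD u.2 false = true :=
    Computable.computablePred_eq (Primrec.list_getD false).to_comp (Computable.const true)
  have h₂ := ((delta_of_computable h₁ n).iff (hA.comp Computable.snd)).forall_lt.comp
    (f := fun z : List Bool => (z, z.length)) (Computable.id.pair Computable.list_length)
  exact h₂.of_iff fun z => eq_initSeg_iff.symm

theorem zeroJump_succ (n : ℕ) : zeroJump (n + 1) = jump (zeroJump n) :=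
  Function.iterate_succ_apply' _ _ _

theorem sigmaPred_zeroJump (n : ℕ) : SigmaPred n fun x => x ∈ zeroJump n := by
  induction n with
  | zero => exact ⟨fun _ => isFalse id, Computable.const false⟩
  | succ n ih =>
    rw [zeroJump_succ]
    have h₁ : SigmaPred (n + 1) fun u : ℕ × List Bool => ((Denumerable.ofNat Code u.1).eval
        (Nat.pair u.1 (Encodable.encode u.2))).Dom :=
      (sigmaPred_one_eval_dom ((Computable.ofNat Code).comp Computable.fst)
        (Primrec₂.natPair.to_comp.comp Computable.fst
          (Computable.encode.comp Computable.snd))).mono (by omega)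
    have h₂ := (deltaPred_eq_initSeg ih.delta_succ).comp
      (f := fun u : ℕ × List Bool => u.2) Computable.snd
    refine ((h₂.1.and h₁).ex).of_iff fun e => ?_
    constructor
    · rintro ⟨z, hz, h⟩
      exact ⟨z.length, by rw [← hz]; exact h⟩
    · rintro ⟨s, hs⟩
      have hl : (initSeg (zeroJump n) s).length = s := by simp [initSeg]
      exact ⟨initSeg (zeroJump n) s, by rw [hl], hs⟩

/-- Every `Σ⁰ₙ` predicate reduces to the `n`-th jump. The disjunct `d` is there for `n = 0`, where
the jump is empty; for larger `n` it is not needed. -/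
theorem SigmaPred.reduces_zeroJump {n : ℕ} {α : Type} [Primcodable α] {p : α → Prop}
    (hp : SigmaPred n p) : ∃ (d : α → Bool) (F : α → ℕ), Computable d ∧ Computable F ∧
      ∀ a, p a ↔ (d a = true ∨ F a ∈ zeroJump n) := by
  induction n generalizing α with
  | zero =>
    obtain ⟨f, hf, rfl⟩ := ComputablePred.computable_iff.1 hp
    exact ⟨f, fun _ => 0, hf, Computable.const 0, fun a => by simp [zeroJump]⟩
  | succ n ih =>
    obtain ⟨q, hq, h⟩ := hp
    obtain ⟨d, F, hd, hF, hdF⟩ := ih hq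
    let t : (α × ℕ × List Bool) × ℕ → Bool := fun u =>
      !(d (u.1.1, u.2)) && !(u.1.2.2.getD (F (u.1.1, u.2)) true)
    have ht : Computable t := by
      have h₁ : Computable fun u : (α × ℕ × List Bool) × ℕ => (u.1.1, u.2) :=
        (Computable.fst.comp Computable.fst).pair Computable.snd
      exact Primrec.and.to_comp.comp (Primrec.not.to_comp.comp (hd.comp h₁))
        (Primrec.not.to_comp.comp ((Primrec.list_getD true).to_comp.comp
          (Computable.snd.comp (Computable.snd.comp Computable.fst)) (hF.comp h₁)))
    have hΨ : Partrec fun u : α × ℕ × List Bool => Nat.rfind fun y => Part.some (t (u, y)) :=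
      Partrec.rfind ht.partrec
    obtain ⟨c, hc⟩ := Code.exists_code.1 hΨ
    refine ⟨fun _ => false, fun a => Encodable.encode (c.curry (Encodable.encode a)),
      Computable.const false, ?_, fun a => ?_⟩
    · exact Computable.encode.comp
        (Code.primrec₂_curry.to_comp.comp (Computable.const c) Computable.encode)
    · have key : ∀ e (z : List Bool), ((c.curry (Encodable.encode a)).eval
          (Nat.pair e (Encodable.encode z))).Dom ↔ ∃ y, t ((a, e, z), y) = true := by
        intro e z
        rw [Code.eval_curry, hc]
        have he : Nat.pair (Encodable.encode a) (Nat.pair e (Encodable.encode z)) =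
          Encodable.encode (a, e, z) := by simp
        rw [he]
        simp only [Encodable.encodek, Part.coe_some, Part.bind_some]
        refine Iff.trans ?_ ((Nat.rfind_dom (p := fun y => Part.some (t ((a, e, z), y)))).trans ?_)
        · exact Iff.rfl
        · simp
      rw [zeroJump_succ, h]
      simp only [jump, relCE, Set.mem_ofPred_eq, Denumerable.ofNat_encode, Bool.false_eq_true,
        false_or, key]
      constructor
      · rintro ⟨y, hy⟩
        have hn : ¬ (d (a, y) = true ∨ F (a, y) ∈ zeroJump n) := fun hh => (hdF _).2 hh hy
        rw [not_or] at hn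
        refine ⟨F (a, y) + 1, y, ?_⟩
        simp only [t, initSeg]
        rw [List.getD_eq_getElem _ _ (by simp)]
        simpa using hn
      · rintro ⟨s, y, hy⟩
        refine ⟨y, by_contra fun hh => ?_⟩
        simp only [t, Bool.and_eq_true, Bool.not_eq_eq_eq_not, Bool.not_true] at hy
        by_cases hl : F (a, y) < s
        · rw [List.getD_eq_getElem _ _ (by simpa [initSeg] using hl)] at hy
          rcases (hdF _).1 hh with h' | h'
          · simp [h'] at hy
          · simp [initSeg, h'] at hy
        · rw [List.getD_eq_default _ _ (by simpa [initSeg] using hl)] at hy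
          simp at hy

/-! ### Functions computable in an iterated jump -/

open Classical in
theorem SigmaPred.recursiveIn_char {n : ℕ} {p : ℕ → Prop} (hp : SigmaPred n p) :
    Nat.RecursiveIn {chi (zeroJump n)} fun k => Part.some (if p k then 1 else 0) := by
  obtain ⟨d, F, hd, hF, h⟩ := hp.reduces_zeroJump
  have h₁ : Nat.RecursiveIn {chi (zeroJump n)} fun k => chi (zeroJump n) (F k) := by
    have := Nat.RecursiveIn.comp (.oracle _ (Set.mem_singleton (chi (zeroJump n))))
      (RecursiveIn.iff_nat.1 (hF.computableIn (O := {chi (zeroJump n)})))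
    exact this.of_eq fun k => Part.bind_some _ _
  have hG : Computable fun u : ℕ × ℕ => bif d u.1 then 1 else u.2 :=
    Computable.cond (hd.comp Computable.fst) (Computable.const 1) Computable.snd
  have h₂ := Nat.RecursiveIn.comp (RecursiveIn.iff_nat.1
    ((hG.comp Computable.unpair).computableIn (O := {chi (zeroJump n)})))
    (Nat.RecursiveIn.pair (RecursiveIn.iff_nat.1
      (Computable.id.computableIn (O := {chi (zeroJump n)}))) h₁)
  refine h₂.of_eq fun k => ?_
  simp only [chi, Seq.seq]
  cases hdk : d k <;> simp [h, hdk]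

/-- A total function with a `Σ⁰ₙ₊₁` graph is computable in the `n`-th jump: search for a pair of a
value and a witness that it is the right one. -/
theorem computableIn_of_sigmaPred_graph {n : ℕ} {α β : Type} [Primcodable α] [Primcodable β]
    [Inhabited α] [Inhabited β] {f : α → β} (hf : SigmaPred (n + 1) fun z : α × β => z.2 = f z.1) :
    ComputableIn {chi (zeroJump n)} f := by
  classical
  obtain ⟨q, hq, h⟩ := hf
  let a : ℕ → α := fun k => (Encodable.decode k).getD default
  let b : ℕ → β × ℕ := fun k => (Encodable.decode k).getD default
  have ha : Computable a := Computable.option_getD Computable.decode (Computable.const _)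
  have hb : Computable b := Computable.option_getD Computable.decode (Computable.const _)
  obtain ⟨P, hPq⟩ : ∃ P : ℕ → Prop, ∀ k, ¬ q ((a k.unpair.1, (b k.unpair.2).1),
    (b k.unpair.2).2) ↔ P k := ⟨_, fun _ => Iff.rfl⟩
  have hP : SigmaPred n P := by
    have u1 : Computable fun k : ℕ => a k.unpair.1 :=
      ha.comp (Computable.fst.comp Computable.unpair)
    have u2 : Computable fun k : ℕ => b k.unpair.2 :=
      hb.comp (Computable.snd.comp Computable.unpair)
    exact SigmaPred.of_iff (SigmaPred.comp hq
      ((u1.pair (Computable.fst.comp u2)).pair (Computable.snd.comp u2))) hPq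
  have h₁ := hP.recursiveIn_char.rfind
  have hG : Computable fun u : ℕ => Encodable.encode (b u).1 :=
    Computable.encode.comp (Computable.fst.comp hb)
  have h₂ := Nat.RecursiveIn.comp
    (RecursiveIn.iff_nat.1 (hG.computableIn (O := {chi (zeroJump n)}))) h₁
  -- numbers that code no element of `α` have to be sent to an undefined value
  have h₃ : Nat.RecursiveIn {chi (zeroJump n)} fun k =>
      Part.bind (Encodable.decode (α := α) k : Part α) fun x => Part.some (Encodable.encode x) :=
    Nat.Partrec.recursiveIn (by simpa [Computable, Partrec] using Computable.id (α := α))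
  have h₄ := Nat.RecursiveIn.comp h₂ h₃
  refine h₄.of_eq fun k => ?_
  cases hk : (Encodable.decode k : Option α) with
  | none => simp
  | some x =>
    simp only [Part.coe_some, Part.bind_some, Part.bind_eq_bind, Part.map_some]
    obtain ⟨y, hy⟩ := (h (x, f x)).1 rfl
    have hex : ¬ P (Nat.pair (Encodable.encode x) (Encodable.encode (f x, y))) := by
      simpa [← hPq, a, b] using hy
    have hm := Nat.find_spec (p := fun m => ¬ P (Nat.pair (Encodable.encode x) m)) ⟨_, hex⟩
    have hmin := fun i => Nat.find_min (p := fun m => ¬ P (Nat.pair (Encodable.encode x) m))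
      ⟨_, hex⟩ (m := i)
    set m := Nat.find (p := fun m => ¬ P (Nat.pair (Encodable.encode x) m)) ⟨_, hex⟩
    have hval : (b m).1 = f x := by
      refine (h (x, (b m).1)).2 ⟨(b m).2, ?_⟩
      simpa [← hPq, a] using hm
    have hr : m ∈ Nat.rfind (fun i => (fun v => decide (v = 0)) <$>
        (Part.some (if P (Nat.pair (Encodable.encode x) i) then 1 else 0) : Part ℕ)) := by
      refine Nat.mem_rfind.2 ⟨?_, ?_⟩
      · simp [hm]
      · intro i hi
        have := hmin i hi
        rw [not_not] at this
        simp [this]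
    exact Part.eq_some_iff.2 (Part.mem_bind_iff.2 ⟨m, hr, by simp [hval]⟩)

theorem computable_of_sigmaPred_graph {α β : Type} [Primcodable α] [Primcodable β]
    [Inhabited α] [Inhabited β] {f : α → β} (hf : SigmaPred 1 fun z : α × β => z.2 = f z.1) :
    Computable f := by
  refine RecursiveIn.partrec_of_oracle (O := {chi (zeroJump 0)}) ?_
    (computableIn_of_sigmaPred_graph hf)
  rintro g rfl
  have : chi (zeroJump 0) = fun _ => Part.some 0 := by
    funext k; simp [chi, zeroJump]
  rw [this]
  exact Computable.const 0

/-- The graph of a function recursive in a `Δ⁰ₙ₊₁` set is `Σ⁰ₙ₊₁`. -/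
theorem sigmaPred_graph_of_recursiveIn {n : ℕ} {A : Set ℕ} (hA : DeltaPred (n + 1) fun x => x ∈ A)
    {f : ℕ →. ℕ} (hf : Nat.RecursiveIn {chi A} f) :
    SigmaPred (n + 1) fun z : ℕ × ℕ => z.2 ∈ f z.1 := by
  have total : ∀ {g : ℕ → ℕ}, Computable g →
      SigmaPred (n + 1) fun z : ℕ × ℕ => z.2 ∈ (Part.some (g z.1) : Part ℕ) := fun hg =>
    (delta_of_computable (Computable.computablePred_eq Computable.snd
      (hg.comp Computable.fst)) _).1.of_iff fun z => by simp
  have pr : Computable₂ Nat.pair := Primrec₂.natPair.to_comp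
  induction hf with
  | zero => exact total (Computable.const 0)
  | succ => exact total Computable.succ
  | left => exact total (Computable.fst.comp Computable.unpair)
  | right => exact total (Computable.snd.comp Computable.unpair)
  | oracle g hg =>
    obtain rfl := hg
    have h₁ := hA.comp (f := fun z : ℕ × ℕ => z.1) Computable.fst
    have e : ∀ k, DeltaPred (n + 1) fun z : ℕ × ℕ => z.2 = k := fun k =>
      delta_of_computable (Computable.computablePred_eq Computable.snd (Computable.const k)) _
    refine ((h₁.and (e 1)).or (h₁.not.and (e 0))).1.of_iff fun z => ?_
    by_cases hz : z.1 ∈ A <;> simp [chi, hz]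
  | @pair f h _ _ ihf ihh =>
    have u : Computable fun z : ℕ × ℕ => z.2.unpair := Computable.unpair.comp Computable.snd
    refine ((ihf.comp (Computable.fst.pair (Computable.fst.comp u))).and
      (ihh.comp (Computable.fst.pair (Computable.snd.comp u)))).of_iff fun z => ?_
    simp only [Seq.seq, Part.mem_bind_iff, Part.map_eq_map, Part.mem_map_iff]
    constructor
    · rintro ⟨h₁, h₂⟩
      exact ⟨_, ⟨_, h₁, rfl⟩, _, h₂, by simp⟩
    · rintro ⟨_, ⟨x, hx, rfl⟩, y, hy, e⟩
      rw [← e]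
      simpa using ⟨hx, hy⟩
  | @comp f h _ _ ihf ihh =>
    have h₁ := ihh.comp (f := fun u : (ℕ × ℕ) × ℕ => (u.1.1, u.2))
      ((Computable.fst.comp Computable.fst).pair Computable.snd)
    have h₂ := ihf.comp (f := fun u : (ℕ × ℕ) × ℕ => (u.2, u.1.2))
      (Computable.snd.pair (Computable.snd.comp Computable.fst))
    exact ((h₁.and h₂).ex).of_iff fun z => 
      (Part.mem_bind_iff (f := h z.1) (g := f) (b := z.2)).symm
  | @prec f h _ _ ihf ihh =>
    have hR : SigmaPred (n + 1) fun u : ℕ × ℕ × ℕ × ℕ =>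
        u.2.2.2 ∈ h (Nat.pair u.1 (Nat.pair u.2.1 u.2.2.1)) := by
      have s : Computable fun u : ℕ × ℕ × ℕ × ℕ => u.2.2 := Computable.snd.comp Computable.snd
      refine ihh.comp (f := fun u : ℕ × ℕ × ℕ × ℕ =>
        (Nat.pair u.1 (Nat.pair u.2.1 u.2.2.1), u.2.2.2)) ((pr.comp Computable.fst (pr.comp
          (Computable.fst.comp Computable.snd) (Computable.fst.comp s))).pair
          (Computable.snd.comp s))
    have u : Computable fun z : ℕ × ℕ => z.1.unpair := Computable.unpair.comp Computable.fst
    refine ((SigmaPred.iterate ihf hR).comp (f := fun z : ℕ × ℕ =>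
      (z.1.unpair.1, z.1.unpair.2, z.2)) ((Computable.fst.comp u).pair
        ((Computable.snd.comp u).pair Computable.snd))).of_iff fun z => ?_
    obtain ⟨k, m⟩ := z
    dsimp only
    generalize k.unpair.1 = a
    generalize k.unpair.2 = j
    constructor
    · rintro ⟨w, h₀, hs, rfl⟩
      have : ∀ i ≤ j, w.getD i 0 ∈ (Nat.rec (f a) (fun y IH => IH >>= fun i =>
          h (Nat.pair a (Nat.pair y i))) i : Part ℕ) := by
        intro i hi
        induction i with
        | zero => exact h₀
        | succ i ih => exact Part.mem_bind_iff.2 ⟨_, ih (by omega), hs i (by omega)⟩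
      exact this j le_rfl
    · intro hm
      have : ∃ w : List ℕ, w.length = j + 1 ∧ w.getD 0 0 ∈ f a ∧ (∀ i < j,
          w.getD (i + 1) 0 ∈ h (Nat.pair a (Nat.pair i (w.getD i 0)))) ∧ w.getD j 0 = m := by
        induction j generalizing m with
        | zero => exact ⟨[m], rfl, hm, by simp, rfl⟩
        | succ j ih =>
          obtain ⟨v, hv, hm⟩ := Part.mem_bind_iff.1 hm
          obtain ⟨w, hl, h₀, hs, hw⟩ := ih v hv
          have g : ∀ i < j + 1, (w ++ [m]).getD i 0 = w.getD i 0 := fun i hi =>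
            List.getD_append _ _ _ _ (by omega)
          have g' : (w ++ [m]).getD (j + 1) 0 = m := by
            rw [List.getD_append_right _ _ _ _ (by omega), hl]; simp
          refine ⟨w ++ [m], by simp [hl], by rwa [g 0 (by omega)], fun i hi => ?_, g'⟩
          rw [g i hi]
          rcases Nat.lt_succ_iff_lt_or_eq.1 hi with hi' | rfl
          · rw [g _ (by omega)]; exact hs i hi'
          · rw [g', hw]; exact hm
      obtain ⟨w, -, h⟩ := this
      exact ⟨w, h⟩
  | @rfind f _ ih =>
    have h₁ := ih.comp (f := fun z : ℕ × ℕ => (Nat.pair z.1 z.2, 0))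
      ((pr.comp Computable.fst Computable.snd).pair (Computable.const 0))
    have h₂ := (ih.comp (f := fun u : (ℕ × ℕ) × ℕ => (Nat.pair u.1.1 u.1.2, u.2 + 1))
      ((pr.comp (Computable.fst.comp Computable.fst) (Computable.snd.comp Computable.fst)).pair
        (Computable.succ.comp Computable.snd))).ex.forall_lt
    refine (h₁.and h₂).of_iff fun z => ?_
    refine Iff.trans ?_ Nat.mem_rfind.symm
    simp only [Part.map_eq_map, Part.mem_map_iff]
    refine and_congr (by simp) (forall₂_congr fun i hi => ?_)
    constructor
    · rintro ⟨b, hb⟩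
      exact ⟨_, hb, by simp⟩
    · rintro ⟨b, hb, hb'⟩
      obtain ⟨b, rfl⟩ := Nat.exists_eq_succ_of_ne_zero (show b ≠ 0 by simpa using hb'.symm)
      exact ⟨b, hb⟩

theorem sigmaPred_graph_of_computableIn {n : ℕ} {α β : Type} [Primcodable α] [Primcodable β]
    {f : α → β} (hf : ComputableIn {chi (zeroJump n)} f) :
    SigmaPred (n + 1) fun z : α × β => z.2 = f z.1 := by
  have h := sigmaPred_graph_of_recursiveIn (sigmaPred_zeroJump n).delta_succ hf
  refine (h.comp (f := fun z : α × β => (Encodable.encode z.1, Encodable.encode z.2))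
    ((Computable.encode.comp Computable.fst).pair (Computable.encode.comp Computable.snd))).of_iff
      fun z => ?_
  simp [Encodable.encodek]

/-! ### Isomorphisms of trees -/

/-- The part of `S` above the node `σ`, as a tree in its own right. -/
def above (S : Set (List ℕ)) (σ : List ℕ) : Set (List ℕ) := {l | σ ++ l ∈ S}

@[simp] theorem mem_above {S : Set (List ℕ)} {σ l : List ℕ} : l ∈ above S σ ↔ σ ++ l ∈ S := Iff.rfl

theorem above_above (S : Set (List ℕ)) (σ τ : List ℕ) :
    above (above S σ) τ = above S (σ ++ τ) := by
  ext l; simp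

theorem IsTree.above {S : Set (List ℕ)} (hS : IsTree S) (σ : List ℕ) : IsTree (above S σ) :=
  fun _ _ h h' => hS _ _ (List.prefix_append_right_inj _ |>.2 h) h'

theorem IsTree.nil_mem {S : Set (List ℕ)} (hS : IsTree S) (h : S.Nonempty) : [] ∈ S :=
  h.elim fun σ hσ => hS _ σ (List.nil_prefix) hσ

theorem IsTree.left {S : Set (List ℕ)} (hS : IsTree S) {σ τ : List ℕ} (h : σ ++ τ ∈ S) : σ ∈ S :=
  hS _ _ (List.prefix_append _ _) h

/-- The length-preserving map on sequences that sends the last entry `c` of `σ ⌢ c` to the label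
`r σ c`. -/
def labelMap (r : List ℕ → ℕ → ℕ) (σ : List ℕ) : List ℕ :=
  (List.range σ.length).map fun i => r (σ.take i) (σ.getD i 0)

section labelMap

variable (r : List ℕ → ℕ → ℕ)

@[simp] theorem length_labelMap (σ : List ℕ) : (labelMap r σ).length = σ.length := by
  simp [labelMap]

@[simp] theorem labelMap_concat (σ : List ℕ) (c : ℕ) :
    labelMap r (σ ++ [c]) = labelMap r σ ++ [r σ c] := by
  simp only [labelMap, List.length_append, List.length_singleton, List.range_succ, List.map_append,
    List.map_cons, List.map_nil]
  congr 1
  · refine List.map_congr_left fun i hi => ?_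
    rw [List.mem_range] at hi
    rw [List.take_append_of_le_length hi.le, List.getD_append _ _ _ _ hi]
  · simp

theorem labelMap_prefix {σ τ : List ℕ} (h : σ <+: τ) : labelMap r σ <+: labelMap r τ := by
  obtain ⟨t, rfl⟩ := h
  induction t using List.reverseRecOn with
  | nil => simp
  | append_singleton t c ih =>
    rw [← List.append_assoc, labelMap_concat]
    exact ih.trans (List.prefix_append _ _)

variable {r} {S T : Set (List ℕ)}

/-- A labelling that at each node matches the children of that node with the children of its image
induces an isomorphism. -/
theorem exists_iso_labelMap (hS : IsTree S) (hT : IsTree T) (h0 : [] ∈ S ↔ [] ∈ T)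
    (h : ∀ σ ∈ S, Set.BijOn (r σ) {c | σ ++ [c] ∈ S} {d | labelMap r σ ++ [d] ∈ T}) :
    ∃ Λ : Iso S T, ∀ σ : S, (Λ σ).1 = labelMap r σ.1 := by
  have hmaps : ∀ σ ∈ S, labelMap r σ ∈ T := by
    intro σ
    induction σ using List.reverseRecOn with
    | nil => exact h0.1
    | append_singleton σ c _ =>
      intro hσ
      rw [labelMap_concat]
      exact (h σ (hS.left hσ)).mapsTo hσ
  have hinj : ∀ σ ∈ S, ∀ τ ∈ S, labelMap r σ = labelMap r τ → σ = τ := by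
    intro σ
    induction σ using List.reverseRecOn with
    | nil =>
      intro _ τ _ e
      have := congrArg List.length e
      simp only [length_labelMap] at this
      exact (List.length_eq_zero_iff.1 this.symm).symm
    | append_singleton σ c ih =>
      intro hσ τ hτ e
      have hl := congrArg List.length e
      simp only [length_labelMap, List.length_append, List.length_singleton] at hl
      rcases List.eq_nil_or_concat τ with rfl | ⟨τ, d, rfl⟩
      · simp at hl
      · rw [List.concat_eq_append] at hτ e ⊢
        rw [labelMap_concat, labelMap_concat] at e
        obtain ⟨e₁, e₂⟩ := List.append_inj' e rfl
        obtain rfl := ih (hS.left hσ) τ (hS.left hτ) e₁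
        have e₂ : r σ c = r σ d := by simpa using e₂
        rw [(h σ (hS.left hσ)).injOn hσ hτ e₂]
  have hsurj : ∀ τ ∈ T, ∃ σ ∈ S, labelMap r σ = τ := by
    intro τ
    induction τ using List.reverseRecOn with
    | nil => exact fun hτ => ⟨[], h0.2 hτ, rfl⟩
    | append_singleton τ d ih =>
      intro hτ
      obtain ⟨σ, hσ, rfl⟩ := ih (hT.left hτ)
      obtain ⟨c, hc, rfl⟩ := (h σ hσ).surjOn hτ
      exact ⟨σ ++ [c], hc, labelMap_concat r σ c⟩
  let f : S → T := fun σ => ⟨labelMap r σ.1, hmaps _ σ.2⟩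
  have hf : Function.Bijective f :=
    ⟨fun σ τ e => Subtype.ext (hinj _ σ.2 _ τ.2 (congrArg Subtype.val e)), fun τ => by
      obtain ⟨σ, hσ, e⟩ := hsurj τ.1 τ.2
      exact ⟨⟨σ, hσ⟩, Subtype.ext e⟩⟩
  refine ⟨⟨Equiv.ofBijective f hf, ?_⟩, fun σ => rfl⟩
  rintro ⟨σ, hσ⟩ ⟨τ, hτ⟩
  refine ⟨fun e => ?_, labelMap_prefix r⟩
  have e : labelMap r σ <+: labelMap r τ := e
  have e' := labelMap_prefix r (List.take_prefix σ.length τ)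
  have hle := e.length_le
  simp only [length_labelMap] at hle
  have hp := List.prefix_of_prefix_length_le e e' (by simpa using hle)
  have heq := hp.eq_of_length (by simpa using hle)
  have hσ' := hinj σ hσ _ (hS _ _ (List.take_prefix _ _) hτ) heq
  change σ <+: τ
  rw [hσ']
  exact List.take_prefix _ _

end labelMap

namespace Iso

variable {S T : Set (List ℕ)} (Λ : Iso S T)

theorem prefix_iff {σ τ : S} : (Λ σ).1 <+: (Λ τ).1 ↔ σ.1 <+: τ.1 := Λ.map_rel_iff

theorem map_nil (hT : IsTree T) (h : [] ∈ S) : (Λ ⟨[], h⟩).1 = [] := by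
  have hn : [] ∈ T := hT.nil_mem ⟨_, (Λ ⟨[], h⟩).2⟩
  obtain ⟨σ, hσ⟩ := Λ.surjective ⟨[], hn⟩
  have h' : (Λ ⟨[], h⟩).1 <+: (Λ σ).1 := Λ.prefix_iff.2 List.nil_prefix
  rw [hσ] at h'
  exact List.prefix_nil.1 h'

/-- An isomorphism sends immediate successors to immediate successors. -/
theorem map_concat (hT : IsTree T) {σ : List ℕ} {c : ℕ} (h : σ ++ [c] ∈ S) (hσ : σ ∈ S) :
    ∃ d, (Λ ⟨σ ++ [c], h⟩).1 = (Λ ⟨σ, hσ⟩).1 ++ [d] := by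
  have hp : (Λ ⟨σ, hσ⟩).1 <+: (Λ ⟨σ ++ [c], h⟩).1 := Λ.prefix_iff.2 (List.prefix_append _ _)
  obtain ⟨t, ht⟩ := hp
  cases t with
  | nil =>
    have := Λ.injective (Subtype.ext (by simpa using ht))
    have := congrArg (fun x : S => x.1.length) this
    simp at this
  | cons d t =>
    have hd : (Λ ⟨σ, hσ⟩).1 ++ [d] ∈ T := by
      refine hT.left (τ := t) ?_
      simp [ht]
    obtain ⟨ρ, hρ⟩ := Λ.surjective ⟨_, hd⟩
    have h₁ : σ <+: ρ.1 := (Λ.prefix_iff (σ := ⟨σ, hσ⟩)).1 (by rw [hρ]; exact List.prefix_append _ _)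
    have h₂ : ρ.1 <+: σ ++ [c] := (Λ.prefix_iff (τ := ⟨σ ++ [c], h⟩)).1 (by
      rw [hρ, ← ht]; exact (List.prefix_append_right_inj _).2 (by simp))
    rcases List.prefix_concat_iff.1 h₂ with e | e
    · have e : ρ = ⟨σ ++ [c], h⟩ := Subtype.ext e
      exact ⟨d, by rw [← e, hρ]⟩
    · have e : ρ = ⟨σ, hσ⟩ := Subtype.ext (e.eq_of_length_le h₁.length_le)
      rw [e] at hρ
      have := congrArg (fun x : T => x.1.length) hρ
      simp at this

theorem length_map (hS : IsTree S) (hT : IsTree T) (σ : S) : (Λ σ).1.length = σ.1.length := by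
  obtain ⟨σ, hσ⟩ := σ
  induction σ using List.reverseRecOn with
  | nil => rw [Λ.map_nil hT]
  | append_singleton σ c ih =>
    obtain ⟨d, hd⟩ := Λ.map_concat hT hσ (hS.left hσ)
    have := ih (hS.left hσ)
    rw [hd]; simp [this]

/-- The restriction of an isomorphism to the part above a node. -/
theorem nonempty_above (σ : S) : Nonempty (Iso (above S σ.1) (above T (Λ σ).1)) := by
  have h₁ : ∀ l : above S σ.1, ∃ l' : above T (Λ σ).1, (Λ σ).1 ++ l'.1 = (Λ ⟨σ.1 ++ l.1, l.2⟩).1 := by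
    intro l
    have hp : (Λ σ).1 <+: (Λ ⟨σ.1 ++ l.1, l.2⟩).1 := Λ.prefix_iff.2 (List.prefix_append _ _)
    obtain ⟨t, ht⟩ := hp
    exact ⟨⟨t, by rw [mem_above, ht]; exact (Λ ⟨σ.1 ++ l.1, l.2⟩).2⟩, ht⟩
  choose f hf using h₁
  have hr : ∀ l l', (f l).1 <+: (f l').1 ↔ l.1 <+: l'.1 := by
    intro l l'
    rw [← List.prefix_append_right_inj (Λ σ).1, hf, hf, Λ.prefix_iff,
      List.prefix_append_right_inj]
  refine ⟨⟨Equiv.ofBijective f ⟨fun l l' e => ?_, fun l' => ?_⟩, fun {l l'} => hr l l'⟩⟩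
  · have e₁ : l.1 <+: l'.1 := (hr _ _).1 (by rw [e])
    have e₂ : l'.1 <+: l.1 := (hr _ _).1 (by rw [e])
    exact Subtype.ext (e₁.eq_of_length_le e₂.length_le)
  · obtain ⟨ρ, hρ⟩ := Λ.surjective ⟨(Λ σ).1 ++ l'.1, l'.2⟩
    have hp : σ.1 <+: ρ.1 := Λ.prefix_iff.1 (by rw [hρ]; exact List.prefix_append _ _)
    obtain ⟨l, hl⟩ := hp
    have hl' : l ∈ above S σ.1 := by rw [mem_above, hl]; exact ρ.2
    refine ⟨⟨l, hl'⟩, Subtype.ext (List.append_cancel_left (as := (Λ σ).1) ?_)⟩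
    rw [hf]
    have : (⟨σ.1 ++ l, hl'⟩ : S) = ρ := Subtype.ext hl
    rw [this, hρ]

theorem exists_child (hT : IsTree T) (hS : IsTree S) {c : ℕ} (h : [c] ∈ S) :
    ∃ d, (Λ ⟨[c], h⟩).1 = [d] ∧ Nonempty (Iso (above S [c]) (above T [d])) := by
  have h0 : [] ∈ S := hS.nil_mem ⟨_, h⟩
  obtain ⟨d, hd⟩ := Λ.map_concat (σ := []) hT h h0
  rw [Λ.map_nil hT h0] at hd
  have hd : (Λ ⟨[c], h⟩).1 = [d] := hd
  refine ⟨d, hd, ?_⟩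
  have := Λ.nonempty_above ⟨[c], h⟩
  rwa [hd] at this

end Iso

/-! ### The kinds of trees of finite height -/

/-- `Kind n N S` classifies the trees `S` of height at most `n`. At level `0` a tree is of kind `0`
if it is not empty and of kind `1` if it is empty. At level `n + 1` the part of `S` above each child
of the root is of kind `0` or `1` at level `n`, the first occurs exactly `N` times, and the second
infinitely often (for `n = 0` there is nothing to require, as these are empty).
Deciding that a computable tree is of kind `0` at level `n` is a `Π⁰ₙ` problem, and a `Σ⁰ₙ` choice
between kinds `1` and `0` can be coded into the construction of a tree. -/
def Kind : ℕ → ℕ∞ → Set (List ℕ) → Prop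
  | 0, N, S => [] ∈ S ↔ N = 0
  | n + 1, N, S => [] ∈ S ∧ (n ≠ 0 → {c | Kind n 1 (above S [c])}.encard = ⊤) ∧
      (∀ c, [c] ∈ S → Kind n 0 (above S [c]) ∨ Kind n 1 (above S [c])) ∧
      {c | Kind n 0 (above S [c])}.encard = N

/-- Membership in the standard tree of height at most `n` and kind `N`. Above an even child of the
root it is standard of kind `1`, above an odd child of kind `0`. -/
def InStd : ℕ → ℕ∞ → List ℕ → Prop
  | 0, N, l => l = [] ∧ N = 0
  | _ + 1, _, [] => True
  | n + 1, N, c :: l => if c % 2 = 0 then InStd n 1 l else ((c / 2 : ℕ) : ℕ∞) < N ∧ InStd n 0 l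

/-- The standard tree of height at most `n` and kind `N`. -/
def std (n : ℕ) (N : ℕ∞) : Set (List ℕ) := {l | InStd n N l}

theorem Kind.nil_mem_zero : ∀ {n : ℕ} {S : Set (List ℕ)}, Kind n 0 S → [] ∈ S
  | 0, _, h => h.2 rfl
  | _ + 1, _, h => h.1

theorem Kind.nil_mem_of_ne_zero {n : ℕ} (hn : n ≠ 0) {N : ℕ∞} {S : Set (List ℕ)} (h : Kind n N S) :
    [] ∈ S := by
  obtain ⟨n, rfl⟩ := Nat.exists_eq_succ_of_ne_zero hn
  exact h.1

theorem Kind.not_one_of_zero : ∀ {n : ℕ} {S : Set (List ℕ)}, Kind n 0 S → ¬ Kind n 1 S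
  | 0, _, h, h' => one_ne_zero (h'.1 (h.2 rfl))
  | _ + 1, _, h, h' => zero_ne_one (h.2.2.2.symm.trans h'.2.2.2)

theorem encard_kind_le {n : ℕ} {N : ℕ∞} {S T : Set (List ℕ)} (hS : IsTree S) (hT : IsTree T)
    (hmem : ∀ S, Kind n N S → [] ∈ S)
    (ih : ∀ {S T : Set (List ℕ)}, IsTree S → IsTree T → Nonempty (Iso S T) → Kind n N S → Kind n N T)
    (Λ : Iso S T) :
    {c | Kind n N (above S [c])}.encard ≤ {c | Kind n N (above T [c])}.encard := by
  have hd : ∀ c, Kind n N (above S [c]) →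
      ∃ d, Kind n N (above T [d]) ∧ ∃ h, (Λ ⟨[c], h⟩).1 = [d] := by
    intro c hc
    have hcS : [c] ∈ S := by simpa using hmem _ hc
    obtain ⟨d, hd, hI⟩ := Λ.exists_child hT hS hcS
    exact ⟨d, ih (hS.above _) (hT.above _) hI hc, hcS, hd⟩
  choose! f hf hf' using hd
  refine Set.encard_le_encard_of_injOn (f := f) (fun c hc => hf c hc) fun c hc c' hc' e => ?_
  obtain ⟨h₁, e₁⟩ := hf' c hc
  obtain ⟨h₂, e₂⟩ := hf' c' hc'
  rw [e] at e₁
  simpa using Λ.injective (Subtype.ext (e₁.trans e₂.symm))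

/-- The kind of a tree is invariant under isomorphism. -/
theorem Kind.of_iso {n : ℕ} {N : ℕ∞} {S T : Set (List ℕ)} (hS : IsTree S) (hT : IsTree T)
    (hI : Nonempty (Iso S T)) (h : Kind n N S) : Kind n N T := by
  induction n generalizing N S T with
  | zero =>
    obtain ⟨Λ⟩ := hI
    have : [] ∈ S ↔ [] ∈ T := ⟨fun h => hT.nil_mem ⟨_, (Λ ⟨_, h⟩).2⟩,
      fun h => hS.nil_mem ⟨_, (Λ.symm ⟨_, h⟩).2⟩⟩
    exact this.symm.trans h
  | succ n ih =>
    obtain ⟨Λ⟩ := hI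
    obtain ⟨h₁, h₂, h₃, h₄⟩ := h
    refine ⟨hT.nil_mem ⟨_, (Λ ⟨_, h₁⟩).2⟩, fun hn => ?_, fun d hd => ?_, ?_⟩
    · have hm : ∀ S, Kind n 1 S → [] ∈ S := fun S h => h.nil_mem_of_ne_zero hn
      exact top_le_iff.1 ((h₂ hn).symm.le.trans (encard_kind_le hS hT hm ih Λ))
    · obtain ⟨c, hc, hI⟩ := Iso.exists_child Λ.symm hS hT hd
      have hcS : [c] ∈ S := by rw [← hc]; exact (Λ.symm ⟨[d], hd⟩).2
      have hI' : Nonempty (Iso (above S [c]) (above T [d])) := hI.map fun Λ => Λ.symm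
      exact (h₃ c hcS).imp (ih (hS.above _) (hT.above _) hI') (ih (hS.above _) (hT.above _) hI')
    · rw [← h₄]
      have hm : ∀ S, Kind n 0 S → [] ∈ S := fun S h => h.nil_mem_zero
      exact le_antisymm (encard_kind_le hT hS hm ih Λ.symm) (encard_kind_le hS hT hm ih Λ)

theorem nil_mem_std {n : ℕ} {N : ℕ∞} : [] ∈ std n N ↔ (n = 0 → N = 0) := by
  cases n <;> simp [std, InStd]

theorem above_std_succ (n : ℕ) (N : ℕ∞) (c : ℕ) : above (std (n + 1) N) [c] =
    if c % 2 = 0 then std n 1 else {l | ((c / 2 : ℕ) : ℕ∞) < N ∧ l ∈ std n 0} := by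
  ext l
  split <;> simp_all [std, InStd]

theorem std_isTree (n : ℕ) (N : ℕ∞) : IsTree (std n N) := by
  induction n generalizing N with
  | zero =>
    rintro σ τ h ⟨rfl, hN⟩
    exact ⟨List.prefix_nil.1 h, hN⟩
  | succ n ih =>
    rintro (_ | ⟨c, σ⟩) τ h hτ
    · exact trivial
    · obtain ⟨t, rfl⟩ := h
      have hτ : σ ++ t ∈ above (std (n + 1) N) [c] := hτ
      change σ ∈ above (std (n + 1) N) [c]
      rw [above_std_succ] at hτ ⊢
      by_cases hc : c % 2 = 0
      · rw [if_pos hc] at hτ ⊢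
        exact (ih _).left hτ
      · rw [if_neg hc] at hτ ⊢
        exact ⟨hτ.1, (ih _).left hτ.2⟩

theorem length_le_of_mem_std {n : ℕ} {N : ℕ∞} {l : List ℕ} (h : l ∈ std n N) : l.length ≤ n := by
  induction n generalizing N l with
  | zero => simp [h.1]
  | succ n ih =>
    cases l with
    | nil => simp
    | cons c l =>
      have h : l ∈ above (std (n + 1) N) [c] := h
      rw [above_std_succ] at h
      split at h
      · simpa using ih h
      · simpa using ih h.2

theorem encard_setOf_lt (N : ℕ∞) : {k : ℕ | (k : ℕ∞) < N}.encard = N := by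
  induction N using ENat.recTopCoe with
  | top => simp
  | coe m =>
    have : {k : ℕ | (k : ℕ∞) < m} = ↑(Finset.range m) := by ext; simp
    rw [this, Set.encard_coe_eq_coe_finsetCard, Finset.card_range]

theorem kind_std {n : ℕ} {N : ℕ∞} : Kind n N (std n N) := by
  induction n generalizing N with
  | zero => exact (nil_mem_std).trans (by simp)
  | succ n ih =>
    have h0 : Kind n 0 (std n 0) := ih
    have h1 : Kind n 1 (std n 1) := ih
    have hodd : ∀ c, Kind n 0 (above (std (n + 1) N) [c]) ↔
        c % 2 ≠ 0 ∧ ((c / 2 : ℕ) : ℕ∞) < N := by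
      intro c
      rw [above_std_succ]
      split <;> rename_i hc
      · simpa [hc] using fun h : Kind n 0 (std n 1) => h.not_one_of_zero h1
      · by_cases hl : ((c / 2 : ℕ) : ℕ∞) < N
        · simpa [hl, hc] using h0
        · simp only [hl, false_and, and_false, iff_false]
          exact fun h => h.nil_mem_zero
    refine ⟨nil_mem_std.2 (by simp), fun hn => ?_, fun c hc => ?_, ?_⟩
    · rw [Set.encard_eq_top_iff]
      refine Set.infinite_of_injective_forall_mem (f := fun k : ℕ => 2 * k)
        (fun a b h => by simpa using h) fun k => ?_
      simpa [above_std_succ] using h1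
    · by_cases h : Kind n 0 (above (std (n + 1) N) [c])
      · exact .inl h
      · right
        rw [hodd] at h
        have hc : [] ∈ above (std (n + 1) N) [c] := hc
        rw [above_std_succ] at hc ⊢
        split at hc
        · rename_i h'; simpa [h'] using h1
        · rename_i h'; exact absurd ⟨h', hc.1⟩ h
    · simp only [hodd]
      conv_rhs => rw [← encard_setOf_lt N]
      have : {c : ℕ | c % 2 ≠ 0 ∧ ((c / 2 : ℕ) : ℕ∞) < N} =
          (fun k => 2 * k + 1) '' {k : ℕ | (k : ℕ∞) < N} := by
        ext c
        constructor
        · rintro ⟨h, h'⟩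
          exact ⟨c / 2, h', by dsimp only; omega⟩
        · rintro ⟨k, hk, rfl⟩
          refine ⟨by dsimp only; omega, ?_⟩
          rw [show (2 * k + 1) / 2 = k by omega]
          exact hk
      rw [this]
      exact Function.Injective.encard_image (fun a b h => by simpa using h) _

/-! ### The canonical isomorphism onto a standard tree -/

theorem bijOn_count (p : ℕ → Prop) [DecidablePred p] :
    Set.BijOn (Nat.count p) {c | p c} {k : ℕ | (k : ℕ∞) < {c | p c}.encard} := by
  refine ⟨fun c hc => ?_, fun c hc c' hc' e => Nat.count_injective hc hc' e, fun k hk => ?_⟩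
  · by_cases hf : {c | p c}.Finite
    · have := Nat.count_lt_card hf hc
      rw [Set.mem_ofPred_eq, hf.encard_eq_coe_toFinset_card]
      exact_mod_cast this
    · have : {c | p c}.encard = ⊤ := Set.encard_eq_top_iff.2 hf
      simp [this]
  · have hk' : ∀ hf : {c | p c}.Finite, k < hf.toFinset.card := by
      intro hf
      rw [Set.mem_ofPred_eq, hf.encard_eq_coe_toFinset_card] at hk
      exact_mod_cast hk
    exact ⟨Nat.nth p k, Nat.nth_mem k hk', Nat.count_nth hk'⟩

/-- The part of `S` above the node `τ` is of kind `0` at the level that is left above `τ` in a tree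
of height `k`. -/
def Marked (k : ℕ) (S : Set (List ℕ)) (τ : List ℕ) : Prop := Kind (k - τ.length) 0 (above S τ)

open Classical in
/-- The position of `σ ⌢ c` in the standard tree: the marked children of a node go to the odd
positions and the others to the even ones, in increasing order. -/
noncomputable def canonLabel (k : ℕ) (S : Set (List ℕ)) (σ : List ℕ) (c : ℕ) : ℕ :=
  if Marked k S (σ ++ [c]) then
    2 * Nat.count (fun i => σ ++ [i] ∈ S ∧ Marked k S (σ ++ [i])) c + 1
  else 2 * Nat.count (fun i => σ ++ [i] ∈ S ∧ ¬ Marked k S (σ ++ [i])) c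

section canonLabel

variable {k m : ℕ} {M : ℕ∞} {S : Set (List ℕ)} {σ : List ℕ}

theorem marked_concat_iff (hm : k - σ.length = m + 1) {c : ℕ} :
    Marked k S (σ ++ [c]) ↔ Kind m 0 (above S (σ ++ [c])) := by
  rw [Marked, List.length_append, List.length_singleton, ← Nat.sub_sub, hm, Nat.add_sub_cancel]

theorem kind_one_of_not_marked (hm : k - σ.length = m + 1) (h : Kind (m + 1) M (above S σ)) {c : ℕ}
    (hc : σ ++ [c] ∈ S) (hn : ¬ Marked k S (σ ++ [c])) : Kind m 1 (above S (σ ++ [c])) := by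
  have := h.2.2.1 c hc
  rw [above_above, ← marked_concat_iff hm] at this
  exact this.resolve_left hn

theorem encard_marked (hm : k - σ.length = m + 1) (h : Kind (m + 1) M (above S σ)) :
    {c | σ ++ [c] ∈ S ∧ Marked k S (σ ++ [c])}.encard = M := by
  rw [← h.2.2.2]
  congr 1
  ext c
  simp only [Set.mem_ofPred_eq, above_above, marked_concat_iff hm, and_iff_right_iff_imp]
  exact fun h => by simpa using h.nil_mem_zero

theorem encard_not_marked (hm : k - σ.length = m + 1) (h : Kind (m + 1) M (above S σ)) :
    {c | σ ++ [c] ∈ S ∧ ¬ Marked k S (σ ++ [c])}.encard = if m = 0 then 0 else ⊤ := by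
  split <;> rename_i h0
  · subst h0
    rw [Set.encard_eq_zero, Set.eq_empty_iff_forall_notMem]
    rintro c ⟨hc, hn⟩
    rw [marked_concat_iff hm] at hn
    exact hn (iff_of_true (by simpa using hc) rfl)
  · rw [← top_le_iff, ← h.2.1 h0]
    refine Set.encard_le_encard fun c hc => ?_
    rw [Set.mem_ofPred_eq, above_above] at hc
    refine ⟨by simpa using hc.nil_mem_of_ne_zero h0, fun hn => ?_⟩
    exact ((marked_concat_iff hm).1 hn).not_one_of_zero hc

theorem above_std_canonLabel (hm : k - σ.length = m + 1) (h : Kind (m + 1) M (above S σ)) {c : ℕ}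
    (hc : σ ++ [c] ∈ S) : ∃ N, Kind m N (above S (σ ++ [c])) ∧
      above (std (m + 1) M) [canonLabel k S σ c] = std m N := by
  classical
  by_cases hk : Marked k S (σ ++ [c])
  · refine ⟨0, (marked_concat_iff hm).1 hk, ?_⟩
    have hl := (bijOn_count fun i => σ ++ [i] ∈ S ∧ Marked k S (σ ++ [i])).mapsTo
      (show c ∈ {i | σ ++ [i] ∈ S ∧ Marked k S (σ ++ [i])} from ⟨hc, hk⟩)
    rw [Set.mem_ofPred_eq, encard_marked hm h] at hl
    rw [canonLabel, if_pos hk, above_std_succ, if_neg (by omega), Nat.mul_add_div two_pos]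
    ext l; simp [hl]
  · refine ⟨1, kind_one_of_not_marked hm h hc hk, ?_⟩
    rw [canonLabel, if_neg hk, above_std_succ, if_pos (by omega)]

theorem canonLabel_bijOn (hm : k - σ.length = m + 1) (h : Kind (m + 1) M (above S σ)) :
    Set.BijOn (canonLabel k S σ) {c | σ ++ [c] ∈ S} {d | [d] ∈ std (m + 1) M} := by
  classical
  have b₁ := bijOn_count fun i => σ ++ [i] ∈ S ∧ Marked k S (σ ++ [i])
  have b₀ := bijOn_count fun i => σ ++ [i] ∈ S ∧ ¬ Marked k S (σ ++ [i])
  rw [encard_marked hm h] at b₁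
  rw [encard_not_marked hm h] at b₀
  have hstd : ∀ d, [d] ∈ std (m + 1) M ↔
      if d % 2 = 0 then m ≠ 0 else ((d / 2 : ℕ) : ℕ∞) < M := by
    intro d
    have : [d] ∈ std (m + 1) M ↔ [] ∈ above (std (m + 1) M) [d] := Iff.rfl
    rw [this, above_std_succ]
    split <;> simp [nil_mem_std]
  refine ⟨fun c hc => ?_, fun c hc c' hc' e => ?_, fun d hd => ?_⟩
  · rw [Set.mem_ofPred_eq, hstd]
    by_cases hk : Marked k S (σ ++ [c])
    · rw [canonLabel, if_pos hk, if_neg (by omega), Nat.mul_add_div two_pos]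
      simpa using b₁.mapsTo (show c ∈ {i | _} from ⟨hc, hk⟩)
    · rw [canonLabel, if_neg hk, if_pos (by omega)]
      have := b₀.mapsTo (show c ∈ {i | _} from ⟨hc, hk⟩)
      intro h0
      simp [h0] at this
  · by_cases hk : Marked k S (σ ++ [c]) <;> by_cases hk' : Marked k S (σ ++ [c'])
    · rw [canonLabel, canonLabel, if_pos hk, if_pos hk'] at e
      exact b₁.injOn ⟨hc, hk⟩ ⟨hc', hk'⟩ (by omega)
    · rw [canonLabel, canonLabel, if_pos hk, if_neg hk'] at e
      omega
    · rw [canonLabel, canonLabel, if_neg hk, if_pos hk'] at e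
      omega
    · rw [canonLabel, canonLabel, if_neg hk, if_neg hk'] at e
      exact b₀.injOn ⟨hc, hk⟩ ⟨hc', hk'⟩ (by omega)
  · rw [Set.mem_ofPred_eq, hstd] at hd
    split at hd <;> rename_i hp
    · obtain ⟨c, ⟨hc, hk⟩, e⟩ := b₀.surjOn (show d / 2 ∈ {i : ℕ | _} by simp [hd])
      refine ⟨c, hc, ?_⟩
      rw [canonLabel, if_neg hk]
      omega
    · obtain ⟨c, ⟨hc, hk⟩, e⟩ := b₁.surjOn (show d / 2 ∈ {i : ℕ | _} from hd)
      refine ⟨c, hc, ?_⟩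
      rw [canonLabel, if_pos hk]
      omega

/-- A tree of height at most `k` and kind `N` is isomorphic to the standard tree by the map with
labels `canonLabel`. -/
theorem exists_canonical_iso {N : ℕ∞} (hS : IsTree S) (hl : ∀ τ ∈ S, τ.length ≤ k)
    (hK : Kind k N S) :
    ∃ Λ : Iso S (std k N), ∀ σ : S, (Λ σ).1 = labelMap (canonLabel k S) σ.1 := by
  have inv : ∀ σ ∈ S, ∃ M, Kind (k - σ.length) M (above S σ) ∧
      above (std k N) (labelMap (canonLabel k S) σ) = std (k - σ.length) M := by
    intro σ
    induction σ using List.reverseRecOn with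
    | nil => exact fun _ => ⟨N, hK, rfl⟩
    | append_singleton σ c ih =>
      intro hc
      obtain ⟨M, h₁, h₂⟩ := ih (hS.left hc)
      have hlen := hl _ hc
      simp only [List.length_append, List.length_singleton] at hlen
      obtain ⟨m, hm⟩ : ∃ m, k - σ.length = m + 1 := ⟨k - σ.length - 1, by omega⟩
      rw [hm] at h₁ h₂
      obtain ⟨M', h₃, h₄⟩ := above_std_canonLabel hm h₁ hc
      have hm' : k - (σ ++ [c]).length = m := by
        simp only [List.length_append, List.length_singleton]; omega
      refine ⟨M', by rwa [hm'], ?_⟩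
      rw [hm', labelMap_concat, ← above_above, h₂, h₄]
  refine exists_iso_labelMap hS (std_isTree _ _) ?_ fun σ hσ => ?_
  · rw [nil_mem_std]
    cases k with
    | zero => simpa using (show [] ∈ S ↔ N = 0 from hK)
    | succ k => simpa using hK.1
  · obtain ⟨M, h₁, h₂⟩ := inv σ hσ
    have e : ∀ d, labelMap (canonLabel k S) σ ++ [d] ∈ std k N ↔ [d] ∈ std (k - σ.length) M := by
      intro d
      rw [← h₂, mem_above]
    simp only [e]
    cases hm : k - σ.length with
    | zero =>
      have h₃ : {c | σ ++ [c] ∈ S} = ∅ := Set.eq_empty_iff_forall_notMem.2 fun c hc => by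
        have := hl _ hc
        simp only [List.length_append, List.length_singleton] at this
        omega
      have h₄ : {d | [d] ∈ std 0 M} = ∅ := Set.eq_empty_iff_forall_notMem.2 fun d hd => by
        simpa using length_le_of_mem_std hd
      rw [h₃, h₄]
      exact Set.bijOn_empty _
    | succ m => rw [hm] at h₁; exact canonLabel_bijOn hm h₁

end canonLabel

theorem nonempty_iso_std_iff {k : ℕ} {N : ℕ∞} {S : Set (List ℕ)} (hS : IsTree S) :
    Nonempty (Iso S (std k N)) ↔ Kind k N S ∧ ∀ τ ∈ S, τ.length ≤ k := by
  constructor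
  · rintro ⟨Λ⟩
    refine ⟨kind_std.of_iso (std_isTree _ _) hS ⟨Λ.symm⟩, fun τ hτ => ?_⟩
    rw [← Iso.length_map Λ hS (std_isTree _ _) ⟨τ, hτ⟩]
    exact length_le_of_mem_std (Λ ⟨τ, hτ⟩).2
  · rintro ⟨h₁, h₂⟩
    obtain ⟨Λ, -⟩ := exists_canonical_iso hS h₂ h₁
    exact ⟨Λ⟩

/-! ### The complexity of the kinds -/

section Complexity

variable {α : Type} [Primcodable α] {n : ℕ}

theorem computable_concat {β : Type} [Primcodable β] {f : β → List ℕ} {g : β → ℕ}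
    (hf : Computable f) (hg : Computable g) : Computable fun b => f b ++ [g b] :=
  Computable.list_concat.comp hf hg

/-- For finite `N`, infinitely many children of the second sort are the same as infinitely many
children. The latter condition has lower complexity. -/
theorem kind_succ_iff {N : ℕ∞} (hN : N ≠ ⊤) {S : Set (List ℕ)} :
    Kind (n + 1) N S ↔ ([] ∈ S ∧ (n ≠ 0 → ∀ m, ∃ c, m ≤ c ∧ [c] ∈ S) ∧
      (∀ c, [c] ∈ S → Kind n 0 (above S [c]) ∨ Kind n 1 (above S [c]))) ∧
      {c | Kind n 0 (above S [c])}.encard = N := by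
  rw [Kind, and_assoc, and_assoc]
  refine and_congr_right fun _ => ?_
  suffices h : (∀ c, [c] ∈ S → Kind n 0 (above S [c]) ∨ Kind n 1 (above S [c])) →
      {c | Kind n 0 (above S [c])}.encard = N → n ≠ 0 →
      ({c | Kind n 1 (above S [c])}.encard = ⊤ ↔ ∀ m, ∃ c, m ≤ c ∧ [c] ∈ S) by
    constructor
    · rintro ⟨h₁, h₂, h₃⟩
      exact ⟨fun hn => (h h₂ h₃ hn).1 (h₁ hn), h₂, h₃⟩
    · rintro ⟨h₁, h₂, h₃⟩
      exact ⟨fun hn => (h h₂ h₃ hn).2 (h₁ hn), h₂, h₃⟩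
  intro h₂ h₃ hn
  have hinf : (∀ m, ∃ c, m ≤ c ∧ [c] ∈ S) ↔ {c | [c] ∈ S}.Infinite := by
    rw [Set.infinite_iff_exists_gt]
    constructor
    · intro h m
      obtain ⟨c, hc, hcS⟩ := h (m + 1)
      exact ⟨c, hcS, hc⟩
    · intro h m
      obtain ⟨c, hcS, hc⟩ := h m
      exact ⟨c, hc.le, hcS⟩
  have hun : {c | [c] ∈ S} = {c | Kind n 0 (above S [c])} ∪ {c | Kind n 1 (above S [c])} := by
    ext c
    refine ⟨h₂ c, ?_⟩
    rintro (h | h)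
    · simpa using h.nil_mem_zero
    · simpa using Kind.nil_mem_of_ne_zero hn h
  have hfin : {c | Kind n 0 (above S [c])}.Finite := by
    rw [← Set.encard_lt_top_iff, h₃]
    exact hN.lt_top
  rw [hinf, Set.encard_eq_top_iff, hun, Set.infinite_union]
  exact ⟨.inr, fun h => h.resolve_left fun h => h hfin⟩

/-- For a uniformly computable family of trees, kind `0` is `Π⁰ₙ` and kind `1` is the conjunction of
a `Π⁰ₙ` and a `Σ⁰ₙ` condition. -/
theorem kind_complexity {T : α → Set (List ℕ)}
    (hT : ComputablePred fun z : α × List ℕ => z.2 ∈ T z.1) (n : ℕ) :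
    PiPred n (fun z : α × List ℕ => Kind n 0 (above (T z.1) z.2)) ∧
    ∃ q r : α × List ℕ → Prop, PiPred n q ∧ SigmaPred n r ∧
      ∀ z, Kind n 1 (above (T z.1) z.2) ↔ q z ∧ r z := by
  induction n with
  | zero =>
    have h : ComputablePred fun z : α × List ℕ => [] ∈ above (T z.1) z.2 :=
      hT.of_eq fun z => by simp
    refine ⟨(delta_of_computable h 0).2.of_iff fun z => by simp [Kind], fun _ => True, _,
      (delta_of_computable ⟨fun _ => isTrue trivial, Computable.const true⟩ 0).2,
      (delta_of_computable h 0).not.1, fun z => by simp [Kind]⟩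
  | succ n ih =>
    obtain ⟨h0, q, r, hq, hr, hqr⟩ := ih
    have hz : Computable fun u : (α × List ℕ) × ℕ => (u.1.1, u.1.2 ++ [u.2]) :=
      (Computable.fst.comp Computable.fst).pair
        (computable_concat (Computable.snd.comp Computable.fst) Computable.snd)
    have k0 := h0.comp hz
    have k1 : DeltaPred (n + 1) fun u : (α × List ℕ) × ℕ =>
        Kind n 1 (above (T u.1.1) (u.1.2 ++ [u.2])) :=
      ((hq.delta_succ.and hr.delta_succ).of_iff fun z => (hqr z).symm).comp hz
    have hch : ComputablePred fun u : (α × List ℕ) × ℕ => u.1.2 ++ [u.2] ∈ T u.1.1 :=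
      ComputablePred.comp hT hz
    have hinf : PiPred (n + 1) fun z : α × List ℕ =>
        n ≠ 0 → ∀ m, ∃ c, m ≤ c ∧ z.2 ++ [c] ∈ T z.1 := by
      by_cases hn : n = 0
      · exact (delta_of_computable ⟨fun _ => isTrue trivial, Computable.const true⟩ _).2.of_iff
          fun z => by simp [hn]
      · have h₁ : ComputablePred fun u : ((α × List ℕ) × ℕ) × ℕ =>
            u.1.2 ≤ u.2 ∧ u.1.1.2 ++ [u.2] ∈ T u.1.1.1 :=
          ComputablePred.and (Primrec.nat_le.comp (Primrec.snd.comp Primrec.fst)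
            Primrec.snd).computablePred (ComputablePred.comp hch
              ((Computable.fst.comp Computable.fst).pair Computable.snd))
        have h₂ := (((delta_of_computable h₁ 1).1.ex).pi_succ.all).mono (show 2 ≤ n + 1 by omega)
        exact h₂.of_iff fun z => by simp [hn]
    have hcommon : PiPred (n + 1) fun z : α × List ℕ => z.2 ∈ T z.1 ∧
        (n ≠ 0 → ∀ m, ∃ c, m ≤ c ∧ z.2 ++ [c] ∈ T z.1) ∧ (∀ c, z.2 ++ [c] ∈ T z.1 →
          Kind n 0 (above (T z.1) (z.2 ++ [c])) ∨ Kind n 1 (above (T z.1) (z.2 ++ [c]))) :=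
      (delta_of_computable hT _).2.and (hinf.and (PiPred.all (PiPred.imp
        (delta_of_computable hch _).1 (k0.delta_succ.or k1).2)))
    constructor
    · refine (hcommon.and k0.not.pi_succ.all).of_iff fun z => ?_
      rw [kind_succ_iff (by simp), Set.encard_eq_zero, Set.eq_empty_iff_forall_notMem]
      simp [above_above]
    · have hun : PiPred (n + 1) fun z : α × List ℕ => ∀ c c',
          ¬ (Kind n 0 (above (T z.1) (z.2 ++ [c])) ∧ Kind n 0 (above (T z.1) (z.2 ++ [c'])) ∧
            c ≠ c') := by
        have hne : ComputablePred fun u : ((α × List ℕ) × ℕ) × ℕ => u.1.2 ≠ u.2 :=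
          ComputablePred.not (Computable.computablePred_eq (Computable.snd.comp Computable.fst)
            Computable.snd)
        exact PiPred.all (PiPred.all ((k0.comp (f := fun u : ((α × List ℕ) × ℕ) × ℕ => u.1)
          Computable.fst).and ((k0.comp (f := fun u : ((α × List ℕ) × ℕ) × ℕ => (u.1.1, u.2))
            ((Computable.fst.comp Computable.fst).pair Computable.snd)).and
              (delta_of_computable hne _).2)).not.pi_succ)
      refine ⟨_, _, hcommon.and hun, k0.sigma_succ.ex, fun z => ?_⟩
      rw [kind_succ_iff (by simp), Set.encard_eq_one]
      simp only [above_above, mem_above, List.append_nil]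
      refine Iff.trans (and_congr_right fun _ => ⟨?_, ?_⟩) and_assoc.symm
      · rintro ⟨c, hc⟩
        have hc' : ∀ d, Kind n 0 (above (T z.1) (z.2 ++ [d])) ↔ d = c := fun d =>
          Set.ext_iff.1 hc d
        refine ⟨fun d d' => ?_, c, (hc' c).2 rfl⟩
        rw [hc', hc']
        rintro ⟨rfl, rfl, h⟩
        exact h rfl
      · rintro ⟨h, c, hc⟩
        refine ⟨c, Set.ext fun d => ⟨fun hd => ?_, ?_⟩⟩
        · by_contra hne
          exact h _ _ ⟨hd, hc, hne⟩
        · rintro rfl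
          exact hc

theorem DeltaPred.exists_le {P : ℕ → α → Prop} (k : ℕ) (h : ∀ j ≤ k, DeltaPred n (P j)) :
    DeltaPred n fun a => ∃ j ≤ k, P j a := by
  induction k with
  | zero => exact (h 0 le_rfl).of_iff fun a => by simp
  | succ k ih =>
    exact ((ih fun j hj => h j (by omega)).or (h (k + 1) le_rfl)).of_iff fun a => by
      simp only [Nat.le_succ_iff, or_and_right, exists_or, exists_eq_left]

theorem deltaPred_marked {S : Set (List ℕ)} (hS : ComputablePred fun σ => σ ∈ S) (k : ℕ) :
    DeltaPred (k + 1) fun u : List ℕ × ℕ => Marked (k + 1) S (u.1 ++ [u.2]) := by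
  have h : DeltaPred (k + 1) fun τ : List ℕ => ∃ j ≤ k, k + 1 - τ.length = j ∧
      Kind j 0 (above S τ) := by
    refine DeltaPred.exists_le k fun j hj => DeltaPred.and ?_ ?_
    · exact delta_of_computable (Computable.computablePred_eq (Primrec.nat_sub.to_comp.comp
        (Computable.const _) Computable.list_length) (Computable.const j)) _
    · have := (kind_complexity (T := fun _ : Unit => S) (ComputablePred.comp hS Computable.snd) j).1
      exact (this.delta_succ.mono (by omega)).comp (f := fun τ => ((), τ))
        ((Computable.const ()).pair Computable.id)
  refine (h.comp (f := fun u : List ℕ × ℕ => u.1 ++ [u.2])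
    (computable_concat Computable.fst Computable.snd)).of_iff fun u => ?_
  constructor
  · rintro ⟨_, _, rfl, h⟩
    exact h
  · intro h
    exact ⟨_, by simp, rfl, h⟩

theorem sigmaPred_count {P : α × ℕ → Prop} [DecidablePred P] (hP : DeltaPred (n + 1) P) :
    SigmaPred (n + 1) fun z : α × ℕ × ℕ => z.2.2 = Nat.count (fun i => P (z.1, i)) z.2.1 := by
  have h₀ : SigmaPred (n + 1) fun z : α × ℕ => z.2 = 0 :=
    (delta_of_computable (Computable.computablePred_eq Computable.snd (Computable.const 0)) _).1
  have c₃ : Computable fun u : α × ℕ × ℕ × ℕ => u.2.2.1 :=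
    Computable.fst.comp (Computable.snd.comp Computable.snd)
  have c₄ : Computable fun u : α × ℕ × ℕ × ℕ => u.2.2.2 :=
    Computable.snd.comp (Computable.snd.comp Computable.snd)
  have hP' := hP.comp (f := fun u : α × ℕ × ℕ × ℕ => (u.1, u.2.1))
    (Computable.fst.pair (Computable.fst.comp Computable.snd))
  have hR := ((hP'.and (delta_of_computable (Computable.computablePred_eq c₄
    (Computable.succ.comp c₃)) _)).or (hP'.not.and (delta_of_computable
      (Computable.computablePred_eq c₄ c₃) _))).1
  refine (SigmaPred.iterate h₀ hR).of_iff fun z => ?_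
  obtain ⟨a, k, m⟩ := z
  dsimp only
  constructor
  · rintro ⟨w, h₀, hs, rfl⟩
    have : ∀ i ≤ k, w.getD i 0 = Nat.count (fun i => P (a, i)) i := by
      intro i hi
      induction i with
      | zero => simpa using h₀
      | succ i ih =>
        rw [Nat.count_succ, ← ih (by omega)]
        rcases hs i (by omega) with ⟨h, h'⟩ | ⟨h, h'⟩ <;> simp only [h, h', if_true, if_false]; rfl
    exact this k le_rfl
  · intro hm
    have g : ∀ i ≤ k, ((List.range (k + 1)).map (Nat.count fun i => P (a, i))).getD i 0 =
        Nat.count (fun i => P (a, i)) i := fun i hi => by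
      rw [List.getD_eq_getElem _ _ (by simpa using Nat.lt_succ_of_le hi)]
      simp
    refine ⟨(List.range (k + 1)).map (Nat.count fun i => P (a, i)), ?_, fun i hi => ?_,
      (g k le_rfl).trans hm.symm⟩
    · rw [g 0 (by omega)]; simp
    · rw [g i (by omega), g (i + 1) (by omega), Nat.count_succ]
      by_cases h : P (a, i) <;> simp [h]

theorem sigmaPred_labelMap {r : List ℕ → ℕ → ℕ}
    (hr : SigmaPred n fun u : (List ℕ × ℕ) × ℕ => u.2 = r u.1.1 u.1.2) :
    SigmaPred n fun z : List ℕ × List ℕ => z.2 = labelMap r z.1 := by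
  have w0 : Computable₂ fun (l : List ℕ) i => l.getD i 0 := (Primrec.list_getD 0).to_comp
  have c : Computable fun u : (List ℕ × List ℕ) × ℕ =>
      ((u.1.1.take u.2, u.1.1.getD u.2 0), u.1.2.getD u.2 0) := by
    have u₁ : Computable fun u : (List ℕ × List ℕ) × ℕ => u.1.1 := Computable.fst.comp Computable.fst
    have u₂ : Computable fun u : (List ℕ × List ℕ) × ℕ => u.1.2 := Computable.snd.comp Computable.fst
    exact ((Primrec.list_take.to_comp.comp Computable.snd u₁).pair (w0.comp u₁ Computable.snd)).pair
      (w0.comp u₂ Computable.snd)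
  have h₁ := (hr.comp c).forall_lt.comp (f := fun z : List ℕ × List ℕ => (z, z.1.length))
    (Computable.id.pair (Computable.list_length.comp Computable.fst))
  have h₂ : ComputablePred fun z : List ℕ × List ℕ => z.2.length = z.1.length :=
    Computable.computablePred_eq (Computable.list_length.comp Computable.snd)
      (Computable.list_length.comp Computable.fst)
  refine ((delta_of_computable h₂ _).1.and h₁).of_iff fun z => ?_
  obtain ⟨σ, τ⟩ := z
  dsimp only
  constructor
  · rintro ⟨hl, h⟩
    refine List.ext_getElem (by simpa using hl) fun i hi hi' => ?_
    have := h i (by omega)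
    rw [List.getD_eq_getElem _ _ hi] at this
    simpa [labelMap] using this
  · rintro rfl
    refine ⟨by simp, fun i hi => ?_⟩
    rw [List.getD_eq_getElem _ _ (by simpa using hi)]
    simp [labelMap]

theorem sigmaPred_canonLabel {S : Set (List ℕ)} (hS : ComputablePred fun σ => σ ∈ S) (k : ℕ) :
    SigmaPred (k + 1) fun u : (List ℕ × ℕ) × ℕ => u.2 = canonLabel (k + 1) S u.1.1 u.1.2 := by
  classical
  have hM := deltaPred_marked hS k
  have hS' : DeltaPred (k + 1) fun u : List ℕ × ℕ => u.1 ++ [u.2] ∈ S :=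
    delta_of_computable (ComputablePred.comp hS
      (computable_concat Computable.fst Computable.snd)) _
  have cc : Computable fun v : ((List ℕ × ℕ) × ℕ) × ℕ => (v.1.1.1, v.1.1.2, v.2) :=
    (Computable.fst.comp (Computable.fst.comp Computable.fst)).pair
      ((Computable.snd.comp (Computable.fst.comp Computable.fst)).pair Computable.snd)
  have h₁ := (sigmaPred_count (hS'.and hM)).comp cc
  have h₂ := (sigmaPred_count (hS'.and hM.not)).comp cc
  have dbl : Computable fun v : ((List ℕ × ℕ) × ℕ) × ℕ => 2 * v.2 :=
    (Primrec.nat_mul.comp (Primrec.const 2) Primrec.snd).to_comp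
  have e₀ : ComputablePred fun v : ((List ℕ × ℕ) × ℕ) × ℕ => v.1.2 = 2 * v.2 :=
    Computable.computablePred_eq (Computable.snd.comp Computable.fst) dbl
  have e₁ : ComputablePred fun v : ((List ℕ × ℕ) × ℕ) × ℕ => v.1.2 = 2 * v.2 + 1 :=
    Computable.computablePred_eq (Computable.snd.comp Computable.fst) (Computable.succ.comp dbl)
  have hM' := hM.comp (f := fun u : (List ℕ × ℕ) × ℕ => u.1) Computable.fst
  refine ((hM'.1.and (h₁.and (delta_of_computable e₁ _).1).ex).or
    (hM'.not.1.and (h₂.and (delta_of_computable e₀ _).1).ex)).of_iff fun u => ?_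
  obtain ⟨⟨σ, c⟩, m⟩ := u
  by_cases h : Marked (k + 1) S (σ ++ [c]) <;>
    simp only [canonLabel, h, true_and, false_and, or_false, false_or, not_true, not_false_iff,
      if_true, if_false]
  all_goals
    constructor
    · rintro ⟨b, hb, hm⟩
      rw [hm, hb]
    · exact fun hm => ⟨_, rfl, hm⟩

end Complexity

/-! ### A computable listing of the computable trees -/

/-- `s` is the first stage at which the program `c` is seen to accept `τ`. -/
def FirstStage (c : Code) (τ : List ℕ) (s : ℕ) : Prop :=
  c.evaln s (Encodable.encode τ) = some 1 ∧ ∀ t < s, c.evaln t (Encodable.encode τ) ≠ some 1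

/-- The `e`-th tree of the listing. An entry of a node codes a pair: the first components form a
sequence accepted, with all its initial segments, by the `e`-th program, and the second components
are the stages at which this is first seen. This makes membership decidable for every `e`. -/
def listing (e : ℕ) : Set (List ℕ) :=
  {l | ∀ i < l.length, FirstStage (Denumerable.ofNat Code e)
    ((l.map fun x => x.unpair.1).take (i + 1)) (l.getD i 0).unpair.2}

theorem nil_mem_listing (e : ℕ) : [] ∈ listing e := fun i hi => by simp at hi

theorem concat_mem_listing {e : ℕ} {l : List ℕ} {d : ℕ} : l ++ [d] ∈ listing e ↔ l ∈ listing e ∧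
    FirstStage (Denumerable.ofNat Code e) ((l.map fun x => x.unpair.1) ++ [d.unpair.1])
      d.unpair.2 := by
  have h₁ : ∀ i < l.length, ((l ++ [d]).map fun x => x.unpair.1).take (i + 1) =
      (l.map fun x => x.unpair.1).take (i + 1) := fun i hi => by
    rw [List.map_append, List.take_append_of_le_length (by simpa using hi)]
  have h₂ : ∀ i < l.length, (l ++ [d]).getD i 0 = l.getD i 0 := fun i hi =>
    List.getD_append _ _ _ _ hi
  constructor
  · intro h
    refine ⟨fun i hi => ?_, ?_⟩
    · rw [← h₁ i hi, ← h₂ i hi]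
      exact h i (by simp; omega)
    · have := h l.length (by simp)
      rw [List.take_of_length_le (by simp)] at this
      simpa using this
  · rintro ⟨h, h'⟩ i hi
    have hi : i < l.length ∨ i = l.length := by
      rw [List.length_append, List.length_singleton] at hi; omega
    rcases hi with hi | rfl
    · rw [h₁ i hi, h₂ i hi]
      exact h i hi
    · rw [List.take_of_length_le (by simp)]
      simpa using h'

theorem isTree_of_concat {S : Set (List ℕ)} (h : ∀ σ c, σ ++ [c] ∈ S → σ ∈ S) : IsTree S := by
  rintro σ _ ⟨t, rfl⟩ ht
  induction t using List.reverseRecOn with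
  | nil => simpa using ht
  | append_singleton t c ih =>
    rw [← List.append_assoc] at ht
    exact ih (h _ _ ht)

theorem listing_isTree (e : ℕ) : IsTree (listing e) :=
  isTree_of_concat fun _ _ h => (concat_mem_listing.1 h).1

theorem computablePred_evaln_eq {α : Type} [Primcodable α] {s x : α → ℕ} {c : α → Code}
    (hs : Computable s) (hc : Computable c) (hx : Computable x) (v : ℕ) :
    ComputablePred fun a => (c a).evaln (s a) (x a) = some v :=
  Computable.computablePred_eq (Code.primrec_evaln.to_comp.comp ((hs.pair hc).pair hx))
    (Computable.const (some v))

theorem computablePred_listing : ComputablePred fun p : ℕ × List ℕ => p.2 ∈ listing p.1 := by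
  have hf : ComputablePred fun u : Code × List ℕ × ℕ => FirstStage u.1 u.2.1 u.2.2 := by
    have cτ : Computable fun u : Code × List ℕ × ℕ => Encodable.encode u.2.1 :=
      Computable.encode.comp (Computable.fst.comp Computable.snd)
    have h₁ := computablePred_evaln_eq (Computable.snd.comp Computable.snd) Computable.fst cτ 1
    have h₂ := computablePred_evaln_eq (α := (Code × List ℕ × ℕ) × ℕ) Computable.snd
      (Computable.fst.comp Computable.fst) (cτ.comp Computable.fst) 1
    exact ComputablePred.and h₁ (ComputablePred.comp (ComputablePred.forall_lt h₂.not)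
      (f := fun u : Code × List ℕ × ℕ => (u, u.2.2))
      (Computable.id.pair (Computable.snd.comp Computable.snd)))
  have cm : Computable fun l : List ℕ => l.map fun x => x.unpair.1 :=
    (Primrec.list_map Primrec.id (Primrec.fst.comp (Primrec.unpair.comp Primrec.snd)).to₂).to_comp
  have u₁ : Computable fun u : (ℕ × List ℕ) × ℕ => u.1.1 := Computable.fst.comp Computable.fst
  have u₂ : Computable fun u : (ℕ × List ℕ) × ℕ => u.1.2 := Computable.snd.comp Computable.fst
  have h := ComputablePred.comp hf (((Computable.ofNat Code).comp u₁).pair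
    ((Primrec.list_take.to_comp.comp (Computable.succ.comp Computable.snd) (cm.comp u₂)).pair
      (Computable.snd.comp (Computable.unpair.comp
        ((Primrec.list_getD 0).to_comp.comp u₂ Computable.snd)))))
  exact ComputablePred.comp (ComputablePred.forall_lt h)
    (f := fun z : ℕ × List ℕ => (z, z.2.length))
    (Computable.id.pair (Computable.list_length.comp Computable.snd))

theorem sigmaPred_graph_of_computable {α β : Type} [Primcodable α] [Primcodable β] {f : α → β}
    (hf : Computable f) (n : ℕ) : SigmaPred n fun z : α × β => z.2 = f z.1 :=
  (delta_of_computable (Computable.computablePred_eq Computable.snd (hf.comp Computable.fst)) n).1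

/-- An index of a nonempty tree is the position in the listing of a computably isomorphic tree: the
isomorphism adds to each entry of a node the stage at which the program accepts it. -/
theorem exists_iso_listing {e : ℕ} {S : Set (List ℕ)} (hS : IsTree S) (hne : S.Nonempty)
    (he : IsIndex e S) : ∃ (g : List ℕ → List ℕ) (Λ : Iso S (listing e)), Computable g ∧
      ∀ σ : S, g σ.1 = (Λ σ).1 := by
  classical
  have hex : ∀ τ : List ℕ, ∃ s, ((Denumerable.ofNat Code e).evaln s (Encodable.encode τ)).isSome :=
    fun τ => eval_dom_iff.1 (by rw [he τ]; trivial)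
  let stage : List ℕ → ℕ := fun τ => Nat.find (hex τ)
  have hstage : Computable stage := Computable.find (computablePred_evaln_isSome
    (Computable.const (Denumerable.ofNat Code e)) Computable.encode) hex
  let r : List ℕ → ℕ → ℕ := fun σ c => Nat.pair c (stage (σ ++ [c]))
  have hr : Computable fun u : List ℕ × ℕ => r u.1 u.2 :=
    Primrec₂.natPair.to_comp.comp Computable.snd
      (hstage.comp (computable_concat Computable.fst Computable.snd))
  have hval : ∀ τ s v, v ∈ (Denumerable.ofNat Code e).evaln s (Encodable.encode τ) →
      v = if τ ∈ S then 1 else 0 := by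
    intro τ s v hv
    have := Code.evaln_sound hv
    rw [he τ] at this
    convert! Part.mem_some_iff.1 this
  have hfirst : ∀ τ s, FirstStage (Denumerable.ofNat Code e) τ s ↔ τ ∈ S ∧ s = stage τ := by
    have hsome : ∀ τ ∈ S, ∀ s, ((Denumerable.ofNat Code e).evaln s (Encodable.encode τ)).isSome →
        (Denumerable.ofNat Code e).evaln s (Encodable.encode τ) = some 1 := by
      intro τ hτ s hs
      obtain ⟨v, hv⟩ := Option.isSome_iff_exists.1 hs
      have := hval τ s v hv
      rw [if_pos hτ] at this
      rw [hv, this]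
    intro τ s
    constructor
    · rintro ⟨h₁, h₂⟩
      have hτ : τ ∈ S := by
        by_contra hτ
        have := hval τ s 1 h₁
        simp [hτ] at this
      refine ⟨hτ, ((Nat.find_eq_iff (hex τ)).2 ⟨by simp [h₁], fun t ht h => ?_⟩).symm⟩
      exact h₂ t ht (hsome τ hτ t h)
    · rintro ⟨hτ, rfl⟩
      refine ⟨hsome τ hτ _ (Nat.find_spec (hex τ)), fun t ht h => ?_⟩
      exact Nat.find_min (hex τ) ht (by simp [h])
  have hmap : ∀ σ, (labelMap r σ).map (fun x => x.unpair.1) = σ := by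
    intro σ
    induction σ using List.reverseRecOn with
    | nil => rfl
    | append_singleton σ c ih => simp [ih, r]
  have hmem : ∀ σ ∈ S, labelMap r σ ∈ listing e := by
    intro σ
    induction σ using List.reverseRecOn with
    | nil => exact fun _ => nil_mem_listing e
    | append_singleton σ c ih =>
      intro h
      rw [labelMap_concat, concat_mem_listing, hmap, hfirst]
      exact ⟨ih (hS.left h), by simpa [r] using h, by simp [r]⟩
  obtain ⟨Λ, hΛ⟩ := exists_iso_labelMap (r := r) hS (listing_isTree e)
    (iff_of_true (hS.nil_mem hne) (nil_mem_listing e)) fun σ hσ => by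
      refine ⟨fun c hc => ?_, fun c _ c' _ h => (Nat.pair_eq_pair.1 h).1, fun d hd => ?_⟩
      · have := hmem _ hc
        rwa [labelMap_concat] at this
      · rw [Set.mem_ofPred_eq, concat_mem_listing, hmap, hfirst] at hd
        refine ⟨d.unpair.1, hd.2.1, ?_⟩
        dsimp only [r]
        rw [← hd.2.2, Nat.pair_unpair]
  refine ⟨labelMap r, Λ, ?_, fun σ => (hΛ σ).symm⟩
  exact computable_of_sigmaPred_graph (sigmaPred_labelMap (sigmaPred_graph_of_computable hr 1))

theorem isTreeListing_listing : IsTreeListing listing where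
  isTree := listing_isTree
  computable := computablePred_listing
  complete e S hS hne he := by
    obtain ⟨g, Λ, hg, h⟩ := exists_iso_listing hS hne he
    exact ⟨Λ, g, hg.computableIn, h⟩

/-- A uniformly computable family of sets of sequences has a one-one computable sequence of
indices. -/
theorem exists_index_family {T : ℕ → Set (List ℕ)}
    (hT : ComputablePred fun z : ℕ × List ℕ => z.2 ∈ T z.1) :
    ∃ f : ℕ → ℕ, Computable f ∧ Function.Injective f ∧ ∀ x, IsIndex (f x) (T x) := by
  classical
  obtain ⟨t, ht, h⟩ := ComputablePred.computable_iff.1 hT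
  have hP : Computable fun z : ℕ × List ℕ => bif t z then 1 else 0 :=
    Computable.cond ht (Computable.const 1) (Computable.const 0)
  obtain ⟨c, hc⟩ := Code.exists_code.1 hP
  refine ⟨fun x => Encodable.encode (c.curry x), Computable.encode.comp
    (Code.primrec₂_curry.to_comp.comp (Computable.const c) Computable.id), fun x y e => ?_,
    fun x σ => ?_⟩
  · exact (Code.curry_inj (Encodable.encode_injective e)).2
  · rw [Denumerable.ofNat_encode, Code.eval_curry, hc]
    have he : Nat.pair x (Encodable.encode σ) = Encodable.encode (x, σ) := by simp
    have hb : σ ∈ T x ↔ t (x, σ) = true := iff_of_eq (congrFun h (x, σ))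
    rw [he]
    simp only [Encodable.encodek, Part.coe_some, Part.bind_some, hb]
    cases ht : t (x, σ) <;> simp [ht]

theorem exists_index {S : Set (List ℕ)} (hS : ComputablePred fun σ => σ ∈ S) :
    ∃ e, IsIndex e S := by
  obtain ⟨f, -, -, h⟩ := exists_index_family (T := fun _ => S)
    (ComputablePred.comp hS Computable.snd)
  exact ⟨f 0, h 0⟩

/-! ### The isomorphism index sets of the standard trees -/

/-- `e` is an index of a nonempty tree, in a form that is visibly `Π⁰₂`. -/
def IsTreeIndex (e : ℕ) : Prop :=
  (∀ σ : List ℕ, ∃ s, (Denumerable.ofNat Code e).evaln s (Encodable.encode σ) = some 0 ∨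
      (Denumerable.ofNat Code e).evaln s (Encodable.encode σ) = some 1) ∧
  (∀ u : (List ℕ × ℕ) × ℕ × ℕ,
    ¬ ((Denumerable.ofNat Code e).evaln u.2.1 (Encodable.encode (u.1.1 ++ [u.1.2])) = some 1 ∧
      (Denumerable.ofNat Code e).evaln u.2.2 (Encodable.encode u.1.1) = some 0)) ∧
  ∀ s, ¬ (Denumerable.ofNat Code e).evaln s (Encodable.encode ([] : List ℕ)) = some 0

theorem isTreeIndex_iff {e : ℕ} :
    IsTreeIndex e ↔ ∃ S : Set (List ℕ), IsTree S ∧ S.Nonempty ∧ IsIndex e S := by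
  classical
  constructor
  · rintro ⟨h₁, h₂, h₃⟩
    let S : Set (List ℕ) := {σ | 1 ∈ (Denumerable.ofNat Code e).eval (Encodable.encode σ)}
    have hmem : ∀ σ, σ ∈ S ↔ 1 ∈ (Denumerable.ofNat Code e).eval (Encodable.encode σ) :=
      fun _ => Iff.rfl
    have hnot : ∀ σ, σ ∉ S → 0 ∈ (Denumerable.ofNat Code e).eval (Encodable.encode σ) := by
      intro σ hσ
      obtain ⟨s, hs | hs⟩ := h₁ σ
      · exact Code.evaln_sound hs
      · exact absurd (Code.evaln_sound hs) hσ
    refine ⟨S, isTree_of_concat fun σ c h => ?_, ⟨[], ?_⟩, fun σ => ?_⟩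
    · by_contra hσ
      obtain ⟨s, hs⟩ := Code.evaln_complete.1 h
      obtain ⟨t, ht⟩ := Code.evaln_complete.1 (hnot σ hσ)
      exact h₂ ((σ, c), s, t) ⟨hs, ht⟩
    · by_contra hσ
      obtain ⟨t, ht⟩ := Code.evaln_complete.1 (hnot _ hσ)
      exact h₃ t ht
    · by_cases hσ : σ ∈ S
      · rw [if_pos hσ]; exact Part.eq_some_iff.2 hσ
      · rw [if_neg hσ]; exact Part.eq_some_iff.2 (hnot σ hσ)
  · rintro ⟨S, hS, hne, he⟩
    have hval : ∀ {τ s v}, (Denumerable.ofNat Code e).evaln s (Encodable.encode τ) = some v →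
        v = if τ ∈ S then 1 else 0 := by
      intro τ s v hv
      have := Code.evaln_sound hv
      rw [he τ] at this
      convert! Part.mem_some_iff.1 this
    refine ⟨fun σ => ?_, ?_, fun s hs => ?_⟩
    · have : (if σ ∈ S then 1 else 0) ∈
          (Denumerable.ofNat Code e).eval (Encodable.encode σ) := by
        rw [he σ]; convert! Part.mem_some _
      obtain ⟨s, hs⟩ := Code.evaln_complete.1 this
      refine ⟨s, ?_⟩
      split at hs
      exacts [.inr hs, .inl hs]
    · rintro ⟨⟨σ, c⟩, s, t⟩ ⟨h₁, h₂⟩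
      have h₃ : σ ++ [c] ∈ S := by
        by_contra h
        simpa [h] using hval h₁
      simpa [hS.left h₃] using hval h₂
    · simpa [hS.nil_mem hne] using hval hs

theorem piPred_isTreeIndex : PiPred 2 IsTreeIndex := by
  have cN := Computable.ofNat Code
  have u₁ : Computable fun u : (ℕ × List ℕ) × ℕ => Denumerable.ofNat Code u.1.1 :=
    cN.comp (Computable.fst.comp Computable.fst)
  have u₂ : Computable fun u : (ℕ × List ℕ) × ℕ => Encodable.encode u.1.2 :=
    Computable.encode.comp (Computable.snd.comp Computable.fst)
  have h₁ := ((delta_of_computable (ComputablePred.or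
    (computablePred_evaln_eq Computable.snd u₁ u₂ 0)
    (computablePred_evaln_eq Computable.snd u₁ u₂ 1)) 1).1.ex.pi_succ).all
  let τ := ℕ × (List ℕ × ℕ) × ℕ × ℕ
  have v₀ : Computable fun u : τ => Denumerable.ofNat Code u.1 := cN.comp Computable.fst
  have v₁ : Computable fun u : τ => u.2.1 := Computable.fst.comp Computable.snd
  have v₂ : Computable fun u : τ => u.2.2 := Computable.snd.comp Computable.snd
  have h₂ := (delta_of_computable (ComputablePred.and
    (computablePred_evaln_eq (Computable.fst.comp v₂) v₀ (Computable.encode.comp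
      (computable_concat (Computable.fst.comp v₁) (Computable.snd.comp v₁))) 1)
    (computablePred_evaln_eq (Computable.snd.comp v₂) v₀ (Computable.encode.comp
      (Computable.fst.comp v₁)) 0)) 2).not.2.all
  have h₃ := (delta_of_computable (computablePred_evaln_eq (α := ℕ × ℕ) Computable.snd
    (cN.comp Computable.fst) (Computable.const (Encodable.encode ([] : List ℕ))) 0) 2).not.2.all
  exact h₁.and (h₂.and h₃)

/-- Passing to the listing, which consists of trees for all indices, turns membership in the
isomorphism index set of a standard tree into a condition on a uniformly computable family. -/
theorem mem_isom_std_iff {n : ℕ} (hn : n ≠ 0) {N : ℕ∞} {e : ℕ} : e ∈ Isom (std n N) ↔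
    (IsTreeIndex e ∧ ∀ τ : List ℕ, τ ∈ listing e → τ.length ≤ n) ∧ Kind n N (listing e) := by
  have hiff : ∀ S, IsTree S → S.Nonempty → IsIndex e S → (Nonempty (Iso S (std n N)) ↔
      Kind n N (listing e) ∧ ∀ τ ∈ listing e, τ.length ≤ n) := by
    intro S hS hne he
    rw [← nonempty_iso_std_iff (listing_isTree e)]
    obtain ⟨_, Λ, _⟩ := exists_iso_listing hS hne he
    exact ⟨fun ⟨Λ'⟩ => ⟨Λ.symm.trans Λ'⟩, fun ⟨Λ'⟩ => ⟨Λ.trans Λ'⟩⟩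
  constructor
  · rintro ⟨S, hS, he, hI⟩
    have hne : S.Nonempty := hI.elim fun Λ =>
      ⟨_, (Λ.symm ⟨[], nil_mem_std.2 fun h => absurd h hn⟩).2⟩
    have := (hiff S hS hne he).1 hI
    exact ⟨⟨isTreeIndex_iff.2 ⟨S, hS, hne, he⟩, this.2⟩, this.1⟩
  · rintro ⟨⟨h₁, h₂⟩, h₃⟩
    obtain ⟨S, hS, hne, he⟩ := isTreeIndex_iff.1 h₁
    exact ⟨S, hS, he, (hiff S hS hne he).2 ⟨h₃, h₂⟩⟩

theorem piPred_isTreeIndex_and_length_le (n : ℕ) :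
    PiPred 2 fun e => IsTreeIndex e ∧ ∀ τ : List ℕ, τ ∈ listing e → τ.length ≤ n := by
  have h : ComputablePred fun u : ℕ × List ℕ => u.2.length ≤ n :=
    (Primrec.nat_le.comp (Primrec.list_length.comp Primrec.snd) (Primrec.const n)).computablePred
  exact piPred_isTreeIndex.and (PiPred.all (PiPred.imp
    (delta_of_computable computablePred_listing 2).1 (delta_of_computable h 2).2))

theorem isPi_isom_std_zero {n : ℕ} (hn : 2 ≤ n) : IsPi n (Isom (std n 0)) := by
  have h := (kind_complexity computablePred_listing n).1.comp (f := fun e : ℕ => (e, []))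
    (Computable.id.pair (Computable.const []))
  rw [isPi_iff]
  exact (((piPred_isTreeIndex_and_length_le n).mono hn).and h).of_iff fun e =>
    (mem_isom_std_iff (by omega)).symm

theorem isPiAndSigma_isom_std_one {n : ℕ} (hn : 2 ≤ n) : IsPiAndSigma n (Isom (std n 1)) := by
  obtain ⟨q, r, hq, hr, h⟩ := (kind_complexity computablePred_listing n).2
  have c : Computable fun e : ℕ => (e, ([] : List ℕ)) := Computable.id.pair (Computable.const [])
  refine ⟨{e | (IsTreeIndex e ∧ ∀ τ : List ℕ, τ ∈ listing e → τ.length ≤ n) ∧ q (e, [])},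
    {e | r (e, [])}, isPi_iff.2 (((piPred_isTreeIndex_and_length_le n).mono hn).and (hq.comp c)),
    isSigma_iff.2 (hr.comp c), Set.ext fun e => ?_⟩
  rw [mem_isom_std_iff (by omega)]
  exact (and_congr_right fun _ => h (e, [])).trans and_assoc.symm

theorem computablePred_mem_std (n : ℕ) (N : ℕ∞) : ComputablePred fun σ => σ ∈ std n N := by
  induction n generalizing N with
  | zero =>
    by_cases hN : N = 0
    · exact (Computable.computablePred_eq Computable.id (Computable.const [])).of_eq
        fun l => by simp [std, InStd, hN]
    · exact ComputablePred.of_eq ⟨fun _ => isFalse id, Computable.const false⟩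
        fun l => by simp [std, InStd, hN]
  | succ n ih =>
    have hlt : PrimrecPred fun k : ℕ => (k : ℕ∞) < N := by
      induction N using ENat.recTopCoe with
      | top => exact PrimrecPred.of_eq ⟨fun _ => isTrue trivial, Primrec.const true⟩ fun k => by simp
      | coe m => exact (Primrec.nat_lt.comp Primrec.id (Primrec.const m)).of_eq fun k => by simp
    have ct : Computable (List.tail : List ℕ → List ℕ) := Primrec.list_tail.to_comp
    have h₀ : ComputablePred fun l : List ℕ => l = [] :=
      Computable.computablePred_eq Computable.id (Computable.const [])
    have h₁ : ComputablePred fun l : List ℕ => l.headI % 2 = 0 :=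
      (Primrec.eq.comp (Primrec.nat_mod.comp Primrec.list_headI (Primrec.const 2))
        (Primrec.const 0)).computablePred
    have h₂ : ComputablePred fun l : List ℕ => ((l.headI / 2 : ℕ) : ℕ∞) < N :=
      (hlt.comp (Primrec.nat_div.comp Primrec.list_headI (Primrec.const 2))).computablePred
    refine (ComputablePred.or h₀ (ComputablePred.or
      (ComputablePred.and h₁ (ComputablePred.comp (ih 1) ct))
      (ComputablePred.and h₁.not (ComputablePred.and h₂ (ComputablePred.comp (ih 0) ct))))).of_eq
        fun l => ?_
    cases l with
    | nil => simp [std, InStd]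
    | cons c l => by_cases hc : c % 2 = 0 <;> simp [std, InStd, hc]

theorem isComputableTree_std (n : ℕ) (N : ℕ∞) : IsComputableTree (std n N) :=
  ⟨std_isTree n N, computablePred_mem_std n N⟩

/-! ### Trees that code a predicate -/

/-- The tree of height at most `n` that is full below level `n` and has the nodes in `R` at that
level. -/
def truncTree (n : ℕ) (R : List ℕ → Prop) : Set (List ℕ) :=
  {l | l.length < n ∨ l.length = n ∧ R l}

theorem truncTree_isTree (n : ℕ) (R : List ℕ → Prop) : IsTree (truncTree n R) := by
  intro σ τ h hτ
  rcases h.length_le.lt_or_eq with hl | hl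
  · rcases hτ with h' | ⟨h', -⟩
    · exact .inl (by omega)
    · exact .inl (by omega)
  · rwa [h.eq_of_length hl]

theorem length_le_of_mem_truncTree {n : ℕ} {R : List ℕ → Prop} {l : List ℕ}
    (h : l ∈ truncTree n R) : l.length ≤ n := by
  rcases h with h | ⟨h, -⟩ <;> omega

theorem above_truncTree_succ (n : ℕ) (R : List ℕ → Prop) (y : ℕ) :
    above (truncTree (n + 1) R) [y] = truncTree n fun l => R (y :: l) := by
  ext l; simp [truncTree]

theorem computablePred_truncTree {α : Type} [Primcodable α] {R : α × List ℕ → Prop}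
    (hR : ComputablePred R) (n : ℕ) :
    ComputablePred fun z : α × List ℕ => z.2 ∈ truncTree n fun l => R (z.1, l) :=
  ComputablePred.or (Primrec.nat_lt.comp (Primrec.list_length.comp Primrec.snd)
    (Primrec.const n)).computablePred (ComputablePred.and (Primrec.eq.comp
      (Primrec.list_length.comp Primrec.snd) (Primrec.const n)).computablePred hR)

/-- A `Σ⁰ₙ` predicate is coded by a uniformly computable family of trees. The part of the `a`-th
tree above the node `y` codes the failure of `q (a, y)`, where `∃ y, q (a, y)` defines the
predicate with at most one witness. -/
theorem exists_truncTree_kind {n : ℕ} {α : Type} [Primcodable α] {p : α → Prop}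
    (hp : SigmaPred n p) : ∃ R : α × List ℕ → Prop, ComputablePred R ∧ ∀ a,
      (p a → Kind n 1 (truncTree n fun l => R (a, l))) ∧
      (¬ p a → Kind n 0 (truncTree n fun l => R (a, l))) := by
  induction n generalizing α with
  | zero =>
    refine ⟨fun z => ¬ p z.1, ComputablePred.not (ComputablePred.comp (p := p) hp Computable.fst),
      fun a => ?_⟩
    simp [Kind, truncTree]
  | succ n ih =>
    obtain ⟨q, hq, hpq, huniq⟩ := hp.exists_unique_witness
    obtain ⟨R, hR, hK⟩ := ih hq
    have hk0 : ∀ a y, Kind n 0 (truncTree n fun l => R ((a, y), l)) ↔ q (a, y) := fun a y =>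
      ⟨fun h => by_contra fun hn => h.not_one_of_zero ((hK (a, y)).1 hn),
        fun h => (hK (a, y)).2 (not_not.2 h)⟩
    refine ⟨fun z => R ((z.1, z.2.headI), z.2.tail), ComputablePred.comp hR ((Computable.fst.pair
      (Primrec.list_headI.to_comp.comp Computable.snd)).pair
        (Primrec.list_tail.to_comp.comp Computable.snd)), fun a => ?_⟩
    have habove : ∀ y, above (truncTree (n + 1) fun l => R ((a, l.headI), l.tail)) [y] =
        truncTree n fun l => R ((a, y), l) := fun y => above_truncTree_succ n _ y
    have hkind : ∀ N : ℕ∞, {y | q (a, y)}.encard = N → N ≠ ⊤ →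
        Kind (n + 1) N (truncTree (n + 1) fun l => R ((a, l.headI), l.tail)) := by
      intro N hN hN'
      have hroot : [] ∈ truncTree (n + 1) fun l => R ((a, l.headI), l.tail) := .inl (by simp)
      refine (kind_succ_iff hN').2 ⟨⟨hroot, fun hn m => ⟨m, le_rfl, .inl ?_⟩, fun c _ => ?_⟩, ?_⟩
      · rw [List.length_singleton]; omega
      · rw [habove]
        by_cases h : q (a, c)
        · exact .inl ((hk0 a c).2 h)
        · exact .inr ((hK (a, c)).1 h)
      · simp only [habove, hk0, hN]
    constructor
    · intro h
      obtain ⟨y, hy⟩ := (hpq a).1 h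
      refine hkind 1 (Set.encard_eq_one.2 ⟨y, Set.ext fun y' => ⟨fun h' => ?_, ?_⟩⟩) (by simp)
      · exact huniq _ _ _ h' hy
      · rintro rfl; exact hy
    · intro h
      refine hkind 0 (Set.encard_eq_zero.2 (Set.eq_empty_iff_forall_notMem.2 fun y hy => ?_))
        (by simp)
      exact h ((hpq a).2 ⟨y, hy⟩)

/-! ### Reductions to the isomorphism index sets -/

theorem disjoint_isom_std {n : ℕ} (hn : n ≠ 0) : Disjoint (Isom (std n 1)) (Isom (std n 0)) := by
  rw [Set.disjoint_left]
  intro e h₁ h₀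
  exact ((mem_isom_std_iff hn).1 h₀).2.not_one_of_zero ((mem_isom_std_iff hn).1 h₁).2

theorem sigmaPiReducible_isom_std {n : ℕ} (hn : n ≠ 0) :
    SigmaPiReducible n (Isom (std n 1)) (Isom (std n 0)) := by
  refine ⟨disjoint_isom_std hn, fun A hA => ?_⟩
  obtain ⟨R, hR, hK⟩ := exists_truncTree_kind (isSigma_iff.1 hA)
  obtain ⟨f, hf, hinj, hidx⟩ := exists_index_family
    (T := fun x => truncTree n fun l => R (x, l)) (computablePred_truncTree hR n)
  have hmem : ∀ x N, Kind n N (truncTree n fun l => R (x, l)) → f x ∈ Isom (std n N) :=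
    fun x N h => ⟨_, truncTree_isTree _ _, hidx x,
      (nonempty_iso_std_iff (truncTree_isTree _ _)).2
        ⟨h, fun _ => length_le_of_mem_truncTree⟩⟩
  exact ⟨f, hf, hinj, fun x hx => hmem x 1 ((hK x).1 hx), fun x hx => hmem x 0 ((hK x).2 hx)⟩

theorem isPiComplete_isom_std_zero {n : ℕ} (hn : 2 ≤ n) : IsPiComplete n (Isom (std n 0)) := by
  refine ⟨isPi_isom_std_zero hn, fun B hB => ?_⟩
  obtain ⟨hd, h⟩ := sigmaPiReducible_isom_std (n := n) (by omega)
  obtain ⟨f, hf, hinj, h₁, h₀⟩ := h Bᶜ hB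
  refine ⟨f, hf, hinj, fun x => ⟨fun hx => h₀ x (not_not.2 hx), fun hx => ?_⟩⟩
  by_contra hxB
  exact Set.disjoint_left.1 hd (h₁ x hxB) hx

/-! ### The complexity of isomorphisms onto the tree of kind `⊤` -/

theorem sigmaPred_graph_comp {α β γ : Type} [Primcodable α] [Primcodable β] [Primcodable γ]
    [Inhabited β] {n : ℕ} {f : α → β} {g : β → γ}
    (hf : SigmaPred (n + 1) fun z : α × β => z.2 = f z.1)
    (hg : SigmaPred (n + 1) fun z : β × γ => z.2 = g z.1) :
    SigmaPred (n + 1) fun z : α × γ => z.2 = g (f z.1) := by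
  have h₁ := hf.comp (f := fun u : (α × γ) × β => (u.1.1, u.2))
    ((Computable.fst.comp Computable.fst).pair Computable.snd)
  have h₂ := hg.comp (f := fun u : (α × γ) × β => (u.2, u.1.2))
    (Computable.snd.pair (Computable.snd.comp Computable.fst))
  exact (h₁.and h₂).ex.of_iff fun z => by simp

/-- The oracle for `S` is not used, as `S` is computable and the isomorphism may depend on `S`. -/
theorem exists_iso_computableIn {α i : ℕ} (hi : IsIndex i (std (α + 1) ⊤)) {S : Set (List ℕ)}
    (hS : IsComputableTree S) (hI : Nonempty (Iso S (listing i))) :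
    ∃ Λ : Iso S (listing i), Λ.IsComputableIn {chi (codes S), chi (zeroJump α)} := by
  obtain ⟨g₂, Λ₂, hg₂, h₂⟩ := exists_iso_listing (std_isTree _ _) ⟨[], nil_mem_std.2 (by simp)⟩ hi
  have hI' : Nonempty (Iso S (std (α + 1) ⊤)) := hI.map fun Λ => Λ.trans Λ₂.symm
  obtain ⟨hK, hl⟩ := (nonempty_iso_std_iff hS.1).1 hI'
  obtain ⟨Λ₁, h₁⟩ := exists_canonical_iso hS.1 hl hK
  refine ⟨Λ₁.trans Λ₂, fun σ => g₂ (labelMap (canonLabel (α + 1) S) σ), ?_, fun σ => ?_⟩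
  · exact (computableIn_of_sigmaPred_graph (sigmaPred_graph_comp
      (sigmaPred_labelMap (sigmaPred_canonLabel hS.2 α))
      (sigmaPred_graph_of_computable hg₂ _))).recursiveIn.mono (by simp)
  · change g₂ (labelMap (canonLabel (α + 1) S) σ.1) = (Λ₂ (Λ₁ σ)).1
    rw [← h₁, h₂]

/-- A computable copy of the standard tree of height at most `α + 1` and kind `⊤` in which the part
above the child `x` of the root is of kind `1` precisely when `p x` holds. -/
theorem exists_copy_coding {α : ℕ} {p : ℕ → Prop} (hp : SigmaPred α p) (h₁ : {x | p x}.Infinite)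
    (h₀ : {x | ¬ p x}.Infinite) : ∃ S : Set (List ℕ), IsComputableTree S ∧
      Nonempty (Iso S (std (α + 1) ⊤)) ∧ ∀ x, (p x → Kind α 1 (above S [x])) ∧
        (¬ p x → Kind α 0 (above S [x])) := by
  obtain ⟨R, hR, hK⟩ := exists_truncTree_kind hp
  let S := truncTree (α + 1) fun l => R (l.headI, l.tail)
  have habove : ∀ x, above S [x] = truncTree α fun l => R (x, l) := fun x =>
    above_truncTree_succ _ _ _
  have hk₁ : ∀ x, p x → Kind α 1 (above S [x]) := fun x h => by rw [habove]; exact (hK x).1 h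
  have hk₀ : ∀ x, ¬ p x → Kind α 0 (above S [x]) := fun x h => by rw [habove]; exact (hK x).2 h
  have hcomp : ComputablePred fun σ => σ ∈ S := by
    have := computablePred_truncTree (α := Unit) (R := fun z => R (z.2.headI, z.2.tail))
      (ComputablePred.comp hR ((Primrec.list_headI.to_comp.comp Computable.snd).pair
        (Primrec.list_tail.to_comp.comp Computable.snd))) (α + 1)
    exact ComputablePred.comp this (f := fun σ : List ℕ => ((), σ))
      ((Computable.const ()).pair Computable.id)
  have hS : IsTree S := truncTree_isTree _ _
  refine ⟨S, ⟨hS, hcomp⟩, (nonempty_iso_std_iff hS).2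
    ⟨⟨.inl (by simp), fun _ => ?_, fun c _ => ?_, ?_⟩, fun _ => length_le_of_mem_truncTree⟩,
    fun x => ⟨hk₁ x, hk₀ x⟩⟩
  · exact Set.encard_eq_top_iff.2 (h₁.mono hk₁)
  · by_cases h : p c
    exacts [.inr (hk₁ c h), .inl (hk₀ c h)]
  · exact Set.encard_eq_top_iff.2 (h₀.mono hk₀)

theorem infinite_setOf_of_affine {p : ℕ → Prop} (c : ℕ) (h : ∀ k, p (4 * k + c)) :
    {x | p x}.Infinite :=
  Set.infinite_of_injective_forall_mem (f := fun k : ℕ => 4 * k + c)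
    (fun a b h => by dsimp only at h; omega) h

/-- For `β < α` the tree of kind `⊤` has a computable copy from which no isomorphism onto it is
computable in the `β`-th jump: such an isomorphism would reveal the kinds of the children, hence
make a properly `Σ⁰_α` predicate `Δ⁰_{β+1}`. -/
theorem exists_copy_not_computableIn {α β i : ℕ} (hβ : β < α) (hi : IsIndex i (std (α + 1) ⊤)) :
    ∃ j : ℕ, Nonempty (Iso (listing j) (listing i)) ∧
      ¬ ∃ Λ : Iso (listing j) (listing i), Λ.IsComputableIn {chi (zeroJump β)} := by
  obtain ⟨a, rfl⟩ : ∃ a, α = a + 1 := ⟨α - 1, by omega⟩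
  obtain ⟨p, hp, hnp⟩ := exists_sigma_not_pi a
  -- `p` is spread out to the even numbers so that both `p'` and its complement are infinite
  let p' : ℕ → Prop := fun x => (x % 2 = 0 ∧ p (x / 2)) ∨ x % 4 = 1
  have hmod : ∀ m r, ComputablePred fun x : ℕ => x % m = r := fun m r =>
    (Primrec.eq.comp (Primrec.nat_mod.comp Primrec.id (Primrec.const m))
      (Primrec.const r)).computablePred
  have hp' : SigmaPred (a + 1) p' :=
    ((delta_of_computable (hmod 2 0) _).1.and (hp.comp (Primrec.nat_div.comp Primrec.id
      (Primrec.const 2)).to_comp)).or (delta_of_computable (hmod 4 1) _).1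
  have hpp' : ∀ x, p x ↔ p' (2 * x) := fun x => by
    have : (2 * x) % 4 ≠ 1 := by omega
    simp [p', this]
  obtain ⟨S, hS, hSI, hkind⟩ := exists_copy_coding hp'
    (infinite_setOf_of_affine 1 fun k => .inr (by omega))
    (infinite_setOf_of_affine 3 fun k => by rintro (⟨h, -⟩ | h) <;> omega)
  obtain ⟨j, hj⟩ := exists_index hS.2
  have hstd : ∀ d, [d] ∈ std (a + 1 + 1) ⊤ := fun d => by
    have : [] ∈ above (std (a + 1 + 1) ⊤) [d] := by
      rw [above_std_succ]
      split <;> simp [nil_mem_std]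
    exact this
  have hSne : S.Nonempty := hSI.elim fun Λ => ⟨_, (Λ.symm ⟨_, hstd 0⟩).2⟩
  obtain ⟨g₁, Λ₁, hg₁, h₁⟩ := exists_iso_listing hS.1 hSne hj
  obtain ⟨g₂, Λ₂, hg₂, h₂⟩ := exists_iso_listing (std_isTree _ _) ⟨_, hstd 0⟩ hi
  refine ⟨j, hSI.map fun Λ => (Λ₁.symm.trans Λ).trans Λ₂, ?_⟩
  rintro ⟨Λ, g, hg, h⟩
  have hroot : ∀ x, ∃ d, g₂ [d] = g (g₁ [x]) ∧ (p' x ↔ d % 2 = 0) := by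
    intro x
    have hx : [x] ∈ S := by
      have : [] ∈ above S [x] := by
        by_cases hx : p' x
        · exact ((hkind x).1 hx).nil_mem_of_ne_zero (by omega)
        · exact ((hkind x).2 hx).nil_mem_zero
      exact this
    let Θ : Iso S (std (a + 1 + 1) ⊤) := Λ₁.trans (Λ.trans Λ₂.symm)
    obtain ⟨d, hd, hI⟩ := Iso.exists_child Θ (std_isTree _ _) hS.1 hx
    refine ⟨d, ?_, ?_⟩
    · have e : Θ ⟨[x], hx⟩ = ⟨[d], hstd d⟩ := Subtype.ext hd
      have e' : Λ (Λ₁ ⟨[x], hx⟩) = Λ₂ ⟨[d], hstd d⟩ := by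
        rw [← e]
        exact (Λ₂.apply_symm_apply _).symm
      rw [h₁ ⟨[x], hx⟩, h, e', h₂ ⟨[d], hstd d⟩]
    · have hN : ∀ {N}, Kind (a + 1) N (above S [x]) → Kind (a + 1) N
          (above (std (a + 1 + 1) ⊤) [d]) :=
        fun h => h.of_iso (hS.1.above _) ((std_isTree _ _).above _) hI
      rw [above_std_succ] at hN
      split at hN <;> rename_i hd2
      · refine iff_of_true (by_contra fun hn => ?_) hd2
        exact (hN ((hkind x).2 hn)).not_one_of_zero (kind_std)
      · refine iff_of_false (fun hpx => ?_) hd2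
        refine Kind.not_one_of_zero ?_ (hN ((hkind x).1 hpx))
        have : {l | ((d / 2 : ℕ) : ℕ∞) < ⊤ ∧ l ∈ std (a + 1) 0} = std (a + 1) 0 := by
          ext l; simp
        rw [this]
        exact kind_std
  have hnot : ∀ x, ¬ p' x ↔ ∃ d, d % 2 ≠ 0 ∧ g₂ [d] = g (g₁ [x]) := by
    intro x
    obtain ⟨d, hd, hpd⟩ := hroot x
    rw [hpd]
    refine ⟨fun h => ⟨d, h, hd⟩, ?_⟩
    rintro ⟨d', hd', e⟩
    have e' := e.trans hd.symm
    rw [h₂ ⟨[d'], hstd d'⟩, h₂ ⟨[d], hstd d⟩] at e'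
    have := Λ₂.injective (Subtype.ext e')
    have : d' = d := by simpa using this
    rwa [← this]
  have hgraph : SigmaPred (β + 1) fun z : ℕ × List ℕ => z.2 = g (g₁ [z.1]) :=
    sigmaPred_graph_comp (f := fun x : ℕ => g₁ [x]) (sigmaPred_graph_of_computable
      (hg₁.comp (Computable.list_cons.comp Computable.id (Computable.const []))) _)
      (sigmaPred_graph_of_computableIn hg)
  have hc : Computable fun u : ℕ × ℕ => (u.1, g₂ [u.2]) := Computable.fst.pair
    (hg₂.comp (Computable.list_cons.comp Computable.snd (Computable.const [])))
  have hpi : PiPred (β + 1) p' :=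
    (((delta_of_computable (ComputablePred.comp (hmod 2 0) Computable.snd).not _).1.and
      (hgraph.comp hc)).ex).of_iff fun x => (hnot x).symm
  exact hnp ((PiPred.comp (hpi.mono (by omega)) (Primrec.nat_mul.comp (Primrec.const 2)
    Primrec.id).to_comp).of_iff fun x => (hpp' x).symm)

end TreeIso

theorem mainTheorem11 :
    (∀ n : ℕ, 2 ≤ n → ∃ TSigma TPi : Set (List ℕ),
      TreeIso.IsComputableTree TSigma ∧ TreeIso.IsComputableTree TPi ∧
      TreeIso.IsPi n (TreeIso.Isom TPi) ∧
      TreeIso.IsPiAndSigma n (TreeIso.Isom TSigma) ∧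
      TreeIso.SigmaPiReducible n (TreeIso.Isom TSigma) (TreeIso.Isom TPi) ∧
      TreeIso.IsPiComplete n (TreeIso.Isom TPi)) ∧
    (∃ T : ℕ → Set (List ℕ), TreeIso.IsTreeListing T ∧
      ∀ α : ℕ, ∃ i : ℕ,
        (∀ S : Set (List ℕ), TreeIso.IsComputableTree S →
          (Nonempty (TreeIso.Iso S (T i)) ↔
            ∃ Λ : TreeIso.Iso S (T i), Λ.IsComputableIn
              {TreeIso.chi (TreeIso.codes S), TreeIso.chi (TreeIso.zeroJump α)})) ∧
        ∀ β : ℕ, β < α → ∃ j : ℕ,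
          Nonempty (TreeIso.Iso (T j) (T i)) ∧
          ¬ ∃ Λ : TreeIso.Iso (T j) (T i),
            Λ.IsComputableIn {TreeIso.chi (TreeIso.zeroJump β)}) := by
  refine ⟨fun n hn => ⟨TreeIso.std n 1, TreeIso.std n 0, TreeIso.isComputableTree_std n 1,
    TreeIso.isComputableTree_std n 0, TreeIso.isPi_isom_std_zero hn,
    TreeIso.isPiAndSigma_isom_std_one hn, TreeIso.sigmaPiReducible_isom_std (by omega),
    TreeIso.isPiComplete_isom_std_zero hn⟩, TreeIso.listing, TreeIso.isTreeListing_listing,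
    fun α => ?_⟩
  obtain ⟨i, hi⟩ := TreeIso.exists_index (TreeIso.computablePred_mem_std (α + 1) ⊤)
  exact ⟨i, fun S hS => ⟨TreeIso.exists_iso_computableIn hi hS, fun ⟨Λ, _⟩ => ⟨Λ⟩⟩,
    fun β hβ => TreeIso.exists_copy_not_computableIn hβ hi⟩
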